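/- **Conventions.** Let $\mathbb F$ be a field. A simplicial complex $C$ on a finite ground set $V$ is a family of subsets of $V$ containing $\emptyset$ and closed under taking subsets (not every element of $V$ need be a vertex); $C[W]=\{F\in C: F\subseteq W\}$; $\tilde\beta_i$ is the $i$-th reduced Betti number over $\mathbb F$ (so $\tilde\beta_{-1}=1$ for the complex $\{\emptyset\}$). For $i\ge -1$ put $$\tau_i(C)=\frac1{|V|+1}\sum_{W\subseteq V}\frac{\tilde\beta_i(C[W])}{\binom{|V|}{|W|}} .$$ A *simplicial $d$-manifold* is a simplicial complex that is a closed $d$-pseudo-manifold (all facets have $d+1$ elements, every face with $d$ elements lies in exactly two facets, and the graph of facets, adjacent when they share such a face, is connected) and whose topological realization is a $d$-manifold; in particular it is closed and connected. It is *$\mathbb F$-orientable* if there is a simplicial $d$-cycle over $\mathbb F$ with all coefficients $\pm1$ on the facets; this always holds if $\operatorname{char}\mathbb F=2$. A *connected sum* $M_1\#M_2$ is formed by choosing facets $D_1$ of $M_1$ and $D_2$ of $M_2$ and a bijection $D_1\to D_2$, removing $D_1$ and $D_2$, and gluing their boundaries along the bijection. **Theorem.** Let $M_1,M_2$ be simplicial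 $d$-manifolds with $d\ge2$ and with $n_1,n_2$ vertices, and let $M_1\#M_2$ be any connected sum of them; it has $n=n_1+n_2-d-1$ vertices. Put $$c(d,n_1,n_2)=\frac1{d+2}-\frac1{n_1+1}-\frac1{n_2+1}+\frac1{n_1+n_2-d} =\frac1{d+2}-\frac1{n_1+1}-\frac1{n_2+1}+\frac1{n+1}.$$ 1. $\tau_i(M_1\#M_2)=\tau_i(M_1)+\tau_i(M_2)$ for $1\le i\le d-2$. 2. $\tau_0(M_1\#M_2)=\tau_0(M_1)+\tau_0(M_2)+c(d,n_1,n_2)$. 3. If $M_1$ and $M_2$ are $\mathbb F$-orientable, then $\tau_{d-1}(M_1\#M_2)=\tau_{d-1}(M_1)+\tau_{d-1}(M_2)+c(d,n_1,n_2)$. In general, with $\varepsilon_k=1$ if $M_k$ is $\mathbb F$-orientable and $\varepsilon_k=0$ otherwise, $$\tau_{d-1}(M_1\#M_2)=\tau_{d-1}(M_1)+\tau_{d-1}(M_2)+\frac1{d+2}-\frac{\varepsilon_1}{n_1+1}-\frac{\varepsilon_2}{n_2+1}+\frac{\varepsilon_1\varepsilon_2}{n_1+n_2-d}.$$ 4.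 For every $i\ge-1$, $\tau_i(M_1\#M_2)$ does not depend on the choices (of facets and of the bijection) made in forming the connected sum. -/

import Mathlib

/-! Simplicial complexes are Mathlib's `PreAbstractSimplicialComplex V`: downward closed families of
nonempty finite subsets of the ground set `V`, in which elements of `V` need not be vertices.
The empty face, which belongs to every complex, is implicit there; `IsFace` adds it. -/

namespace TauVector

open Finset

variable {V : Type*}

/-- Faces, including the empty face. -/
def IsFace (C : PreAbstractSimplicialComplex V) (s : Finset V) : Prop :=
  s = ∅ ∨ s ∈ C

/-- Facets: maximal faces. -/
def IsFacet (C : PreAbstractSimplicialComplex V) (s : Finset V) : Prop :=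
  s ∈ C ∧ ∀ t ∈ C, s ⊆ t → s = t

/-- The number `f₀` of vertices. -/
noncomputable def vertexCount (C : PreAbstractSimplicialComplex V) : ℕ :=
  {v : V | {v} ∈ C}.ncard

/-- The induced subcomplex `C[W]`, as a complex on the same ground set. -/
def induced (C : PreAbstractSimplicialComplex V) (W : Finset V) :
    PreAbstractSimplicialComplex V where
  faces := {s | s ∈ C ∧ s ⊆ W}
  isRelLowerSet_faces := fun _ hs =>
    ⟨(C.isRelLowerSet_faces hs.1).1, fun _ hts ht =>
      ⟨(C.isRelLowerSet_faces hs.1).2 hts ht, hts.trans hs.2⟩⟩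

/-! ### Reduced simplicial homology -/

section Homology

variable (F : Type*) [Field F] [Fintype V] [DecidableEq V]

/-- The oriented simplicial chains of `C` on simplices with `k` vertices (of dimension `k - 1`).
A chain is written through its coefficients on ordered simplices: `c v` is the coefficient of the
oriented simplex `[v 0, …, v (k - 1)]`. It changes by the sign of a permutation of the vertices,
and it vanishes unless the `v i` are distinct and span a face. The dimension of this space is the
number of faces with `k` elements; for `k = 0` it is `F`. -/
def chains (C : PreAbstractSimplicialComplex V) (k : ℕ) : Submodule F ((Fin k → V) → F) where
  carrier := {c | (∀ (σ : Equiv.Perm (Fin k)) (v : Fin k → V),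
      c (v ∘ σ) = ((Equiv.Perm.sign σ : ℤ) : F) * c v) ∧
    ∀ v : Fin k → V, c v ≠ 0 → Function.Injective v ∧ IsFace C (univ.image v)}
  add_mem' := by
    rintro a b ⟨ha, ha'⟩ ⟨hb, hb'⟩
    refine ⟨fun σ v => by simp only [Pi.add_apply, ha, hb]; ring, fun v hv => ?_⟩
    by_cases h : a v = 0
    · exact hb' v (fun h' => hv (by simp [h, h']))
    · exact ha' v h
  zero_mem' := ⟨by simp, by simp⟩
  smul_mem' := by
    rintro r a ⟨ha, ha'⟩
    refine ⟨fun σ v => by simp only [Pi.smul_apply, ha, smul_eq_mul]; ring, fun v hv => ?_⟩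
    exact ha' v (fun h => hv (by simp [h]))

/-- The simplicial boundary: the coefficient of `∂ c` on `[w 0, …, w (k - 1)]` is the sum over all
vertices `x` of the coefficient of `c` on `[x, w 0, …, w (k - 1)]`. On oriented chains this is the
usual `∂ [v 0, …, v k] = ∑ i, (-1) ^ i [v 0, …, omit v i, …, v k]`; for `k = 0` it is the
augmentation. -/
def boundary (k : ℕ) : ((Fin (k + 1) → V) → F) →ₗ[F] ((Fin k → V) → F) where
  toFun c := fun w => ∑ x : V, c (Fin.cons x w)
  map_add' _ _ := by ext w; simp [Finset.sum_add_distrib]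
  map_smul' _ _ := by ext w; simp [Finset.mul_sum]

/-- Cycles of the reduced chain complex, on simplices with `k` vertices. -/
def cycles (C : PreAbstractSimplicialComplex V) : (k : ℕ) → Submodule F ((Fin k → V) → F)
  | 0 => chains F C 0
  | k + 1 => chains F C (k + 1) ⊓ LinearMap.ker (boundary F k)

/-- Boundaries of the reduced chain complex, on simplices with `k` vertices. -/
def boundaries (C : PreAbstractSimplicialComplex V) (k : ℕ) : Submodule F ((Fin k → V) → F) :=
  (chains F C (k + 1)).map (boundary F k)

/-- The reduced Betti number of `C` in dimension `i`, for `i ≥ -1`. -/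
noncomputable def reducedBetti (C : PreAbstractSimplicialComplex V) (i : ℤ) : ℕ :=
  Module.finrank F
    (cycles F C (i + 1).toNat ⧸
      (boundaries F C (i + 1).toNat).submoduleOf (cycles F C (i + 1).toNat))

/-- The `τ`-vector of `C` over the field `F`, for `i ≥ -1`. -/
noncomputable def tau (C : PreAbstractSimplicialComplex V) (i : ℤ) : ℚ :=
  1 / ((Fintype.card V : ℚ) + 1) *
    ∑ W : Finset V,
      (reducedBetti F (induced C W) i : ℚ) / ((Fintype.card V).choose W.card : ℚ)

/-- `F`-orientability of a `d`-dimensional complex: the facets can be oriented coherently, that is,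
there is a `d`-cycle with all coefficients `±1` on the (oriented) facets. -/
def IsOrientable (d : ℕ) (C : PreAbstractSimplicialComplex V) : Prop :=
  ∃ c ∈ cycles F C (d + 1), ∀ v : Fin (d + 1) → V, Function.Injective v →
    univ.image v ∈ C → c v = 1 ∨ c v = -1

end Homology

/-! ### Triangulated manifolds -/

/-- Pure of dimension `d`: all facets have `d + 1` elements (and there is a facet, so that the
complex without nonempty faces, of dimension `-1`, is excluded). -/
def IsPure (d : ℕ) (C : PreAbstractSimplicialComplex V) : Prop :=
  (∃ s, IsFacet C s) ∧ ∀ s, IsFacet C s → s.card = d + 1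

/-- The adjacency graph: facets are adjacent if they share a common ridge. -/
def adjacencyGraph (d : ℕ) (C : PreAbstractSimplicialComplex V) :
    SimpleGraph {s : Finset V // IsFacet C s} where
  Adj s t := s ≠ t ∧ ∃ r ∈ C, r.card = d ∧ r ⊆ s.1 ∧ r ⊆ t.1
  symm := ⟨fun _ _ ⟨h, r, hr, hc, h₁, h₂⟩ => ⟨h.symm, r, hr, hc, h₂, h₁⟩⟩
  loopless := ⟨fun _ h => h.1 rfl⟩

/-- Closed `d`-dimensional pseudo-manifolds. -/
structure IsClosedPseudomanifold (d : ℕ) (C : PreAbstractSimplicialComplex V) : Prop where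
  pure : IsPure d C
  stronglyConnected : (adjacencyGraph d C).Connected
  ridge : ∀ r ∈ C, r.card = d → {s | IsFacet C s ∧ r ⊆ s}.ncard = 2

/-- The topological realization of a complex on a finite ground set, as a subspace of `ℝ^V`:
barycentric coordinates whose support is a face. -/
def realization [Fintype V] (C : PreAbstractSimplicialComplex V) : Set (V → ℝ) :=
  {x | (∀ v, 0 ≤ x v) ∧ ∑ v, x v = 1 ∧ univ.filter (fun v => x v ≠ 0) ∈ C}

/-- Closed triangulated `d`-manifolds (without boundary, connected): closed pseudo-manifolds whose
realization is a topological `d`-manifold. The realization is automatically compact, Hausdorff and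
second countable. -/
structure IsClosedManifold [Fintype V] (d : ℕ) (C : PreAbstractSimplicialComplex V) : Prop
    extends IsClosedPseudomanifold d C where
  locallyEuclidean : Nonempty (ChartedSpace (EuclideanSpace ℝ (Fin d)) (realization C))

/-! ### Connected sums -/

section ConnectedSum

variable {V₁ V₂ : Type*} [DecidableEq V₁] [DecidableEq V₂]

/-- Removal of the face `s` (and of the faces containing it: for a facet `s`, only `s` itself). -/
def removeFace (C : PreAbstractSimplicialComplex V) (s : Finset V) :
    PreAbstractSimplicialComplex V where
  faces := {t | t ∈ C ∧ ¬ s ⊆ t}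
  isRelLowerSet_faces := fun _ ht =>
    ⟨(C.isRelLowerSet_faces ht.1).1, fun _ hut hu =>
      ⟨(C.isRelLowerSet_faces ht.1).2 hut hu, fun h => ht.2 (h.trans hut)⟩⟩

/-- The ground set of a connected sum: `V₁` and `V₂` with `D₂ ⊆ V₂` identified with `D₁ ⊆ V₁`
through the bijection `φ`. -/
abbrev GluedVertices (V₁ : Type*) {V₂ : Type*} (D₂ : Finset V₂) : Type _ :=
  V₁ ⊕ {v : V₂ // v ∉ D₂}

/-- The map from `V₂` to the glued ground set. -/
def glueRight {D₁ : Finset V₁} {D₂ : Finset V₂} (φ : D₁ ≃ D₂) (v : V₂) : GluedVertices V₁ D₂ :=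
  if h : v ∈ D₂ then Sum.inl (φ.symm ⟨v, h⟩).1 else Sum.inr ⟨v, h⟩

/-- The simplicial connected sum of `M₁` and `M₂` formed with the facets `D₁`, `D₂` and the
bijection `φ`: remove `D₁` and `D₂`, then glue the boundaries of `D₁` and `D₂` along `φ`. -/
def connectedSum (M₁ : PreAbstractSimplicialComplex V₁) (M₂ : PreAbstractSimplicialComplex V₂)
    {D₁ : Finset V₁} {D₂ : Finset V₂} (φ : D₁ ≃ D₂) :
    PreAbstractSimplicialComplex (GluedVertices V₁ D₂) :=
  (removeFace M₁ D₁).map Sum.inl ⊔ (removeFace M₂ D₂).map (glueRight φ)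

end ConnectedSum

/-- The constant `c(d, n₁, n₂)`; here `n₁ + n₂ - d = n + 1`, where `n = n₁ + n₂ - d - 1` is the
number of vertices of the connected sum. -/
def sumConst (d n₁ n₂ : ℕ) : ℚ :=
  1 / ((d : ℚ) + 2) - 1 / ((n₁ : ℚ) + 1) - 1 / ((n₂ : ℚ) + 1) + 1 / ((n₁ : ℚ) + n₂ - d)

open Classical in
/-- `1` for `F`-orientable complexes, `0` for the others. -/
noncomputable def orientIndicator (F : Type*) [Field F] [Fintype V] [DecidableEq V] (d : ℕ)
    (C : PreAbstractSimplicialComplex V) : ℚ :=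
  if IsOrientable F d C then 1 else 0

end TauVector

set_option linter.unusedSectionVars false

namespace TauVector

open Finset

variable {V : Type*}

/-! ### Chains -/

/-! The factor 1/(|V|+1) and the binomial coefficients give a subset of size `k` of an `n`-element
ground set the weight `weight n k`, the integral of t^k (1-t)^(n-k) over [0,1]. So `τ` is the
expected Betti number of `C[W]` when t is uniform on [0,1] and each element is put into W
independently with probability t. Hence `τ` does not see ground-set elements that are not vertices
(`average_preimage`, `tau_map`), and W contains a given set A with probability 1/(|A|+1); the same
holds for avoiding A.

Both summands can therefore be placed on the glued ground set, where they meet exactly in the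
simplex on a common facet D. For fixed W, Mayer-Vietoris compares the Betti numbers
(`betti_glue_induced`). If D ⊆ W, the two pieces meet in the boundary sphere of D; only dimensions
d-1 and d change, depending on whether a d-cycle passes through D in each induced subcomplex. By
strong connectivity this happens exactly when the summand is orientable and W contains all its
vertices (`hasCycleThrough_induced_iff`). If D misses W, the union is disjoint and only dimensions
-1 and 0 change. Otherwise the pieces meet in a nonempty simplex and Betti numbers add.

The corrections are combinations of indicators of "W contains A" and "W avoids A" with A equal to D,
either vertex set, or their union; averaging them gives 1/(d+2), 1/(n₁+1), 1/(n₂+1) and 1/(n+1). The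
result involves only d, the vertex counts and orientability, hence no choice of facets or bijection.
-/

theorem mem_sup_complex {C D : PreAbstractSimplicialComplex V} {s : Finset V} :
    s ∈ C ⊔ D ↔ s ∈ C ∨ s ∈ D := Iff.rfl

theorem mem_inf_complex {C D : PreAbstractSimplicialComplex V} {s : Finset V} :
    s ∈ C ⊓ D ↔ s ∈ C ∧ s ∈ D := Iff.rfl

theorem nonempty_of_mem {C : PreAbstractSimplicialComplex V} {s : Finset V} (h : s ∈ C) :
    s.Nonempty := (C.isRelLowerSet_faces h).1

theorem mem_of_subset {C : PreAbstractSimplicialComplex V} {s t : Finset V} (h : s ∈ C)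
    (hts : t ⊆ s) (ht : t.Nonempty) : t ∈ C := (C.isRelLowerSet_faces h).2 hts ht

theorem IsFace.of_subset {C : PreAbstractSimplicialComplex V} {s t : Finset V} (h : IsFace C s)
    (hts : t ⊆ s) : IsFace C t := by
  rcases t.eq_empty_or_nonempty with rfl | ht
  · exact Or.inl rfl
  · rcases h with rfl | h
    · exact absurd (subset_empty.1 hts) ht.ne_empty
    · exact Or.inr (mem_of_subset h hts ht)

section

variable {F : Type*} [Field F] [Fintype V] [DecidableEq V]

@[simp] theorem boundary_apply {k : ℕ} (c : (Fin (k + 1) → V) → F) (w : Fin k → V) :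
    boundary F k c w = ∑ x : V, c (Fin.cons x w) := rfl

theorem image_comp_perm {k : ℕ} (v : Fin k → V) (σ : Equiv.Perm (Fin k)) :
    univ.image (v ∘ σ) = univ.image v := by
  ext x
  simp only [mem_image, mem_univ, true_and, Function.comp]
  exact ⟨fun ⟨i, h⟩ => ⟨σ i, h⟩, fun ⟨i, h⟩ => ⟨σ.symm i, by simpa using h⟩⟩

theorem image_cons {k : ℕ} (x : V) (w : Fin k → V) :
    univ.image (Fin.cons x w : Fin (k + 1) → V) = insert x (univ.image w) := by
  ext y
  simp [Fin.exists_fin_succ, eq_comm]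

theorem card_image_of_injective' {k : ℕ} {v : Fin k → V} (hv : Function.Injective v) :
    (univ.image v).card = k := by
  rw [card_image_of_injective _ hv, card_univ, Fintype.card_fin]

theorem sign_smul_ne_zero {k : ℕ} (σ : Equiv.Perm (Fin k)) {a : F} :
    ((Equiv.Perm.sign σ : ℤ) : F) * a = 0 ↔ a = 0 := by
  rcases Int.units_eq_one_or (Equiv.Perm.sign σ) with h | h <;> simp [h]

theorem chains_comp_perm_eq_zero {C : PreAbstractSimplicialComplex V} {k : ℕ}
    {c : (Fin k → V) → F} (hc : c ∈ chains F C k) (σ : Equiv.Perm (Fin k)) (v : Fin k → V) :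
    c (v ∘ σ) = 0 ↔ c v = 0 := by
  rw [hc.1, sign_smul_ne_zero]

/-- Two injective enumerations of the same set differ by a permutation. -/
theorem exists_perm_of_image_eq {k : ℕ} {v w : Fin k → V}
    (hw : Function.Injective w) (h : univ.image v = univ.image w) :
    ∃ σ : Equiv.Perm (Fin k), w = v ∘ σ := by
  have h1 : ∀ i, ∃ j, v j = w i := fun i => by
    have : w i ∈ univ.image v := h ▸ mem_image_of_mem w (mem_univ i)
    simpa using this
  choose f hf using h1
  have hinj : Function.Injective f := fun i j hij => hw (by rw [← hf, ← hf, hij])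
  exact ⟨Equiv.ofBijective f (Finite.injective_iff_bijective.1 hinj), funext fun i => (hf i).symm⟩

theorem exists_injective_image_eq {k : ℕ} {s : Finset V} (hs : s.card = k) :
    ∃ v : Fin k → V, Function.Injective v ∧ univ.image v = s := by
  let e := (s.equivFinOfCardEq hs).symm
  refine ⟨fun i => e i, fun i j h => e.injective (Subtype.ext h), ?_⟩
  ext x
  simp only [mem_image, mem_univ, true_and]
  exact ⟨fun ⟨i, h⟩ => h ▸ (e i).2, fun h => ⟨e.symm ⟨x, h⟩, by simp⟩⟩

theorem chains_eq_zero_of_image_eq {C : PreAbstractSimplicialComplex V} {k : ℕ}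
    {c : (Fin k → V) → F} (hc : c ∈ chains F C k) {v w : Fin k → V}
    (h : univ.image v = univ.image w) (h0 : c v = 0) : c w = 0 := by
  by_contra hne
  obtain ⟨σ, rfl⟩ := exists_perm_of_image_eq (hc.2 _ hne).1 h
  exact hne ((chains_comp_perm_eq_zero hc _ _).2 h0)

/-- `decomposeFin.symm (0, σ)` fixes `0` and acts as `σ` on the successors, so it has the sign of
`σ`. -/
theorem cons_comp_perm {k : ℕ} (x : V) (w : Fin k → V) (σ : Equiv.Perm (Fin k)) :
    (Fin.cons x (w ∘ σ) : Fin (k + 1) → V) =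
      Fin.cons x w ∘ Equiv.Perm.decomposeFin.symm (0, σ) := by
  ext i
  refine Fin.cases ?_ (fun i => ?_) i <;> simp

theorem boundary_mem_chains {C : PreAbstractSimplicialComplex V} {k : ℕ}
    {c : (Fin (k + 1) → V) → F} (hc : c ∈ chains F C (k + 1)) :
    boundary F k c ∈ chains F C k := by
  refine ⟨fun σ w => ?_, fun w hw => ?_⟩
  · simp only [boundary_apply, mul_sum]
    refine sum_congr rfl fun x _ => ?_
    rw [cons_comp_perm, hc.1, Equiv.Perm.decomposeFin.symm_sign]
    simp
  · obtain ⟨x, -, hx⟩ := exists_ne_zero_of_sum_ne_zero hw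
    obtain ⟨h1, h2⟩ := hc.2 _ hx
    refine ⟨(Fin.cons_injective_iff.1 h1).2, h2.of_subset ?_⟩
    rw [image_cons]
    exact subset_insert _ _

theorem cons_cons_swap {k : ℕ} (x y : V) (w : Fin k → V) :
    (Fin.cons x (Fin.cons y w : Fin (k + 1) → V) : Fin (k + 2) → V) ∘ Equiv.swap 0 1 =
      Fin.cons y (Fin.cons x w : Fin (k + 1) → V) := by
  ext i
  refine Fin.cases ?_ (fun i => Fin.cases ?_ (fun i => ?_) i) i
  · simp
  · simp
  · rw [Function.comp_apply, Equiv.swap_apply_of_ne_of_ne]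
    · simp
    · exact Fin.succ_ne_zero _
    · rw [← Fin.succ_zero_eq_one]
      exact fun h => Fin.succ_ne_zero _ (Fin.succ_injective _ h)

theorem boundary_boundary {C : PreAbstractSimplicialComplex V} {k : ℕ}
    {c : (Fin (k + 2) → V) → F} (hc : c ∈ chains F C (k + 2)) :
    boundary F k (boundary F (k + 1) c) = 0 := by
  ext w
  simp only [boundary_apply, Pi.zero_apply]
  rw [← sum_product' (s := univ) (t := univ)
    (f := fun x y => c (Fin.cons y (Fin.cons x w : Fin (k + 1) → V)))]
  refine sum_involution (fun p _ => (p.2, p.1)) ?_ ?_ (fun _ _ => by simp) (fun _ _ => rfl)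
  · rintro ⟨x, y⟩ -
    have := hc.1 (Equiv.swap 0 1) (Fin.cons y (Fin.cons x w : Fin (k + 1) → V))
    rw [cons_cons_swap, Equiv.Perm.sign_swap (by simp)] at this
    simp [this]
  -- Diagonal terms vanish because chains live on injective tuples; antisymmetry alone would not
  -- suffice in characteristic 2.
  · rintro ⟨x, y⟩ - hne heq
    have := Fin.cons_injective_iff.1 (hc.2 _ hne).1
    simp only [Prod.mk.injEq] at heq
    obtain ⟨rfl, -⟩ := heq
    exact this.1 ⟨0, by simp⟩

theorem boundaries_le_cycles (C : PreAbstractSimplicialComplex V) (k : ℕ) :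
    boundaries F C k ≤ cycles F C k := by
  rintro _ ⟨c, hc, rfl⟩
  cases k with
  | zero => exact boundary_mem_chains hc
  | succ k => exact ⟨boundary_mem_chains hc, boundary_boundary hc⟩

theorem cycles_le_chains (C : PreAbstractSimplicialComplex V) (k : ℕ) :
    cycles F C k ≤ chains F C k := by
  cases k with
  | zero => exact le_rfl
  | succ k => exact inf_le_left

theorem boundaries_le_chains (C : PreAbstractSimplicialComplex V) (k : ℕ) :
    boundaries F C k ≤ chains F C k := (boundaries_le_cycles C k).trans (cycles_le_chains C k)

/-! ### Betti numbers by rank counting. -/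

variable (F) in
/-- The rank of the boundary map on simplices with `k` vertices. -/
noncomputable def boundaryRank (C : PreAbstractSimplicialComplex V) : ℕ → ℕ
  -- The reduced complex ends at the empty simplex, so nothing leaves degree `0`.
  | 0 => 0
  | k + 1 => Module.finrank F (boundaries F C k)

variable (F) in
/-- The reduced Betti number, indexed by the number of vertices of a simplex. -/
noncomputable def betti (C : PreAbstractSimplicialComplex V) (k : ℕ) : ℕ :=
  reducedBetti F C ((k : ℤ) - 1)

theorem finrank_cycles (C : PreAbstractSimplicialComplex V) (k : ℕ) :
    Module.finrank F (cycles F C k) + boundaryRank F C k = Module.finrank F (chains F C k) := by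
  cases k with
  | zero => rfl
  | succ k =>
    have h := ((boundary F k).domRestrict (chains F C (k + 1))).finrank_range_add_finrank_ker
    have h1 : LinearMap.range ((boundary F k).domRestrict (chains F C (k + 1))) =
        boundaries F C k := by
      rw [LinearMap.range_domRestrict]; rfl
    have h2 : Module.finrank F (LinearMap.ker ((boundary F k).domRestrict (chains F C (k + 1)))) =
        Module.finrank F (cycles F C (k + 1)) := by
      rw [LinearMap.ker_domRestrict]
      have : cycles F C (k + 1) = ((LinearMap.ker (boundary F k)).submoduleOf
          (chains F C (k + 1))).map (chains F C (k + 1)).subtype := by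
        rw [Submodule.submoduleOf, Submodule.map_comap_subtype]
        rfl
      rw [this]
      exact (LinearEquiv.finrank_eq (Submodule.equivSubtypeMap _ _))
    rw [h1, h2] at h
    rw [boundaryRank, ← h, add_comm]

theorem betti_add_finrank_boundaries (C : PreAbstractSimplicialComplex V) (k : ℕ) :
    betti F C k + Module.finrank F (boundaries F C k) = Module.finrank F (cycles F C k) := by
  have hk : ((k : ℤ) - 1 + 1).toNat = k := by simp
  rw [betti, reducedBetti, hk]
  have h := Submodule.finrank_quotient_add_finrank
    ((boundaries F C k).submoduleOf (cycles F C k))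
  rw [← h]
  congr 1
  exact (LinearEquiv.finrank_eq (Submodule.submoduleOfEquivOfLe (boundaries_le_cycles C k))).symm

/-- Only dimensions of chain spaces and ranks of boundary maps remain, so Mayer-Vietoris becomes a
dimension count. -/
theorem betti_eq (C : PreAbstractSimplicialComplex V) (k : ℕ) :
    (betti F C k : ℤ) = Module.finrank F (chains F C k) - boundaryRank F C k -
      Module.finrank F (boundaries F C k) := by
  have h1 := finrank_cycles (F := F) C k
  have h2 := betti_add_finrank_boundaries (F := F) C k
  omega

/-! ### Unions and intersections -/

theorem chains_mono {C D : PreAbstractSimplicialComplex V} (h : C ≤ D) (k : ℕ) :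
    chains F C k ≤ chains F D k :=
  fun _ hc => ⟨hc.1, fun v hv => ⟨(hc.2 v hv).1, (hc.2 v hv).2.imp_right fun h' => h h'⟩⟩

theorem boundaries_mono {C D : PreAbstractSimplicialComplex V} (h : C ≤ D) (k : ℕ) :
    boundaries F C k ≤ boundaries F D k := Submodule.map_mono (chains_mono h _)

theorem chains_inf (C D : PreAbstractSimplicialComplex V) (k : ℕ) :
    chains F (C ⊓ D) k = chains F C k ⊓ chains F D k := by
  refine le_antisymm (le_inf (chains_mono inf_le_left k) (chains_mono inf_le_right k)) ?_
  rintro c ⟨hC, hD⟩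
  refine ⟨hC.1, fun v hv => ⟨(hC.2 v hv).1, ?_⟩⟩
  rcases (hC.2 v hv).2 with h | h
  · exact Or.inl h
  · rcases (hD.2 v hv).2 with h' | h'
    · exact Or.inl h'
    · exact Or.inr ⟨h, h'⟩

open Classical in
/-- The part of a chain that is supported on tuples whose image satisfies `p`. -/
noncomputable def restrictChain {k : ℕ} (p : Finset V → Prop) (c : (Fin k → V) → F) :
    (Fin k → V) → F := fun v => if p (univ.image v) then c v else 0

theorem restrictChain_mem {C D : PreAbstractSimplicialComplex V} {k : ℕ} (p : Finset V → Prop)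
    {c : (Fin k → V) → F} (hc : c ∈ chains F C k)
    (hp : ∀ s, IsFace C s → p s → IsFace D s) : restrictChain p c ∈ chains F D k := by
  refine ⟨fun σ v => ?_, fun v hv => ?_⟩
  · have h : p (univ.image (v ∘ σ)) ↔ p (univ.image v) := by rw [image_comp_perm]
    by_cases hv : p (univ.image v)
    · simp only [restrictChain, h, hv, if_true, hc.1 σ v]
    · simp only [restrictChain, h, hv, if_false, mul_zero]
  · simp only [restrictChain, ne_eq, ite_eq_right_iff, Classical.not_imp] at hv
    exact ⟨(hc.2 v hv.2).1, hp _ (hc.2 v hv.2).2 hv.1⟩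

theorem chains_sup (C D : PreAbstractSimplicialComplex V) (k : ℕ) :
    chains F (C ⊔ D) k = chains F C k ⊔ chains F D k := by
  refine le_antisymm ?_ (sup_le (chains_mono le_sup_left k) (chains_mono le_sup_right k))
  intro c hc
  -- A chain splits according to the underlying face of each tuple, which permutations do not
  -- change.
  have hsum : c = restrictChain (IsFace C) c + restrictChain (fun s => ¬ IsFace C s) c := by
    ext v
    by_cases h : IsFace C (univ.image v) <;> simp [restrictChain, h]
  rw [hsum]
  refine Submodule.add_mem_sup (restrictChain_mem _ hc fun _ _ h => h)
    (restrictChain_mem _ hc fun s h h' => ?_)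
  rcases h with h | h | h
  · exact Or.inl h
  · exact absurd (Or.inr h) h'
  · exact Or.inr h

theorem boundaries_sup (C D : PreAbstractSimplicialComplex V) (k : ℕ) :
    boundaries F (C ⊔ D) k = boundaries F C k ⊔ boundaries F D k := by
  rw [boundaries, chains_sup, Submodule.map_sup]; rfl

/-- Modulo `boundaries F (C ⊓ D) k`, the left side is the kernel of H(C ∩ D) → H(C) ⊕ H(D). -/
theorem boundaries_inf_le_cycles (C D : PreAbstractSimplicialComplex V) (k : ℕ) :
    boundaries F C k ⊓ boundaries F D k ≤ cycles F (C ⊓ D) k := by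
  intro c hc
  have h : c ∈ chains F (C ⊓ D) k := by
    rw [chains_inf]
    exact ⟨boundaries_le_chains _ _ hc.1, boundaries_le_chains _ _ hc.2⟩
  cases k with
  | zero => exact h
  | succ k => exact ⟨h, (boundaries_le_cycles _ _ hc.1).2⟩

theorem boundaries_inf_le (C D : PreAbstractSimplicialComplex V) (k : ℕ) :
    boundaries F (C ⊓ D) k ≤ boundaries F C k ⊓ boundaries F D k :=
  le_inf (boundaries_mono inf_le_left k) (boundaries_mono inf_le_right k)

/-! ### Mayer-Vietoris as a dimension count. -/

variable (F) in
/-- The dimension of the kernel of the map from the homology of an intersection to the sum of the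
homologies, indexed by the number of vertices of a simplex. -/
noncomputable def excess (C D : PreAbstractSimplicialComplex V) (k : ℕ) : ℤ :=
  Module.finrank F (boundaries F C k ⊓ boundaries F D k : Submodule F ((Fin k → V) → F)) -
    Module.finrank F (boundaries F (C ⊓ D) k)

variable (F) in
/-- `excess` one degree below. -/
noncomputable def excessPred (C D : PreAbstractSimplicialComplex V) : ℕ → ℤ
  | 0 => 0
  | k + 1 => excess F C D k

/-- The Mayer-Vietoris count. -/
theorem betti_sup_add_betti_inf (C D : PreAbstractSimplicialComplex V) (k : ℕ) :
    (betti F (C ⊔ D) k : ℤ) + betti F (C ⊓ D) k =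
      betti F C k + betti F D k + excess F C D k + excessPred F C D k := by
  -- Boundaries of a union are sums of boundaries, while those of an intersection may be smaller
  -- than the intersection of boundaries; `excess` measures this failure of modularity. The chain
  -- spaces themselves are exactly modular.
  have hB : ∀ k, (Module.finrank F (boundaries F (C ⊔ D) k) : ℤ) =
      Module.finrank F (boundaries F C k) + Module.finrank F (boundaries F D k) -
        Module.finrank F (boundaries F (C ⊓ D) k) - excess F C D k := fun k => by
    have := Submodule.finrank_sup_add_finrank_inf_eq (boundaries F C k) (boundaries F D k)
    rw [boundaries_sup, excess]
    omega
  have hP := Submodule.finrank_sup_add_finrank_inf_eq (chains F C k) (chains F D k)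
  rw [← chains_sup, ← chains_inf] at hP
  have hR : (boundaryRank F (C ⊔ D) k : ℤ) = boundaryRank F C k + boundaryRank F D k -
      boundaryRank F (C ⊓ D) k - excessPred F C D k := by
    cases k with
    | zero => rfl
    | succ k => exact hB k
  simp only [betti_eq]
  rw [hR, hB k]
  omega

theorem betti_eq_zero_iff (C : PreAbstractSimplicialComplex V) (k : ℕ) :
    betti F C k = 0 ↔ cycles F C k = boundaries F C k := by
  have h := betti_add_finrank_boundaries (F := F) C k
  constructor
  · intro h0
    exact (Submodule.eq_of_le_of_finrank_eq (boundaries_le_cycles C k) (by omega)).symm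
  · intro h0
    rw [h0] at h
    omega

/-- The intersection of the boundary spaces is squeezed between the boundaries and the cycles of `C
⊓ D`, which coincide. -/
theorem excess_eq_zero {C D : PreAbstractSimplicialComplex V} {k : ℕ}
    (h : betti F (C ⊓ D) k = 0) : excess F C D k = 0 := by
  rw [betti_eq_zero_iff] at h
  rw [excess, le_antisymm ((boundaries_inf_le_cycles C D k).trans h.le) (boundaries_inf_le C D k),
    sub_self]

/-- If the intersection is acyclic then Betti numbers add up. -/
theorem betti_sup_of_acyclic {C D : PreAbstractSimplicialComplex V}
    (h : ∀ k, betti F (C ⊓ D) k = 0) (k : ℕ) :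
    betti F (C ⊔ D) k = betti F C k + betti F D k := by
  have h1 := betti_sup_add_betti_inf (F := F) C D k
  have h2 : excessPred F C D k = 0 := by
    cases k with
    | zero => rfl
    | succ k => exact excess_eq_zero (h k)
  rw [excess_eq_zero (h k), h2, h k] at h1
  omega

/-! ### Intersections with the homology of a sphere. -/

variable (F) in
/-- The complex has the homology of a sphere, generated by the cycle `z` on simplices with `m`
vertices, and no simplices with `m + 1` vertices. -/
structure IsHomologySphere (C : PreAbstractSimplicialComplex V) (m : ℕ)
    (z : (Fin m → V) → F) : Prop where
  ne_zero : z ≠ 0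
  cycles_eq : cycles F C m = Submodule.span F {z}
  boundaries_eq : boundaries F C m = ⊥
  acyclic : ∀ k, k ≠ m → betti F C k = 0

theorem IsHomologySphere.betti_eq_one {C : PreAbstractSimplicialComplex V} {m : ℕ}
    {z : (Fin m → V) → F} (h : IsHomologySphere F C m z) : betti F C m = 1 := by
  have h1 := betti_add_finrank_boundaries (F := F) C m
  rw [h.boundaries_eq, h.cycles_eq, finrank_span_singleton h.ne_zero, finrank_bot] at h1
  exact h1

-- The intersection of the boundary spaces lies in the line spanned by `z`, so it is that line or
-- zero.
open Classical in
theorem IsHomologySphere.excess_eq {C D : PreAbstractSimplicialComplex V} {m : ℕ}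
    {z : (Fin m → V) → F} (h : IsHomologySphere F (C ⊓ D) m z) :
    excess F C D m = if z ∈ boundaries F C m ∧ z ∈ boundaries F D m then 1 else 0 := by
  rw [excess, h.boundaries_eq, finrank_bot]
  have hle := (boundaries_inf_le_cycles (F := F) C D m).trans h.cycles_eq.le
  split_ifs with hz
  · rw [le_antisymm hle (by rw [Submodule.span_singleton_le_iff_mem]; exact hz),
      finrank_span_singleton h.ne_zero]
    rfl
  · have : boundaries F C m ⊓ boundaries F D m = ⊥ := by
      rw [eq_bot_iff]
      intro c hc
      obtain ⟨a, rfl⟩ := Submodule.mem_span_singleton.1 (hle hc)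
      rcases eq_or_ne a 0 with rfl | ha
      · simp
      · refine absurd ?_ hz
        exact (Submodule.smul_mem_iff (boundaries F C m ⊓ boundaries F D m) ha).1 hc
    rw [this, finrank_bot]
    rfl

open Classical in
/-- Mayer-Vietoris for an intersection with the homology of a sphere. -/
theorem IsHomologySphere.betti_sup {C D : PreAbstractSimplicialComplex V} {m : ℕ}
    {z : (Fin m → V) → F} (h : IsHomologySphere F (C ⊓ D) m z) (k : ℕ) :
    (betti F (C ⊔ D) k : ℤ) = betti F C k + betti F D k +
      (if k = m then
        (if z ∈ boundaries F C m ∧ z ∈ boundaries F D m then 1 else 0) - 1 else 0) +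
      (if k = m + 1 then
        (if z ∈ boundaries F C m ∧ z ∈ boundaries F D m then 1 else 0) else 0) := by
  have h1 := betti_sup_add_betti_inf (F := F) C D k
  have h2 : excessPred F C D k = if k = m + 1 then
      (if z ∈ boundaries F C m ∧ z ∈ boundaries F D m then 1 else 0) else 0 := by
    cases k with
    | zero => simp [excessPred]
    | succ k =>
      rw [excessPred]
      by_cases hk : k = m
      · subst hk
        rw [h.excess_eq, if_pos rfl]
      · rw [excess_eq_zero (h.acyclic k hk), if_neg (by omega)]
  rw [h2] at h1
  by_cases hk : k = m
  · subst hk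
    rw [h.excess_eq, h.betti_eq_one] at h1
    simp only [if_pos]
    push_cast at h1
    linarith
  · rw [h.acyclic k hk, excess_eq_zero (h.acyclic k hk)] at h1
    rw [if_neg hk]
    push_cast at h1
    linarith

end

/-! ### Cones and simplices -/

section

variable {F : Type*} [Field F] [Fintype V] [DecidableEq V]

open Classical in
/-- The cone with apex `s` over a chain. -/
noncomputable def cone {k : ℕ} (s : V) (c : (Fin k → V) → F) : (Fin (k + 1) → V) → F := fun v =>
  if h : Function.Injective v ∧ ∃ ρ : Equiv.Perm (Fin (k + 1)), v (ρ 0) = s then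
    ((Equiv.Perm.sign h.2.choose : ℤ) : F) * c (Fin.tail (v ∘ h.2.choose)) else 0

theorem exists_perm_apply_zero {k : ℕ} {v : Fin (k + 1) → V} {s : V} (h : s ∈ univ.image v) :
    ∃ ρ : Equiv.Perm (Fin (k + 1)), v (ρ 0) = s := by
  obtain ⟨i, -, rfl⟩ := mem_image.1 h
  exact ⟨Equiv.swap 0 i, by simp⟩

theorem sign_mul_sign_mul {k : ℕ} (σ : Equiv.Perm (Fin k)) (a : F) :
    ((Equiv.Perm.sign σ : ℤ) : F) * (((Equiv.Perm.sign σ : ℤ) : F) * a) = a := by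
  rcases Int.units_eq_one_or (Equiv.Perm.sign σ) with h | h <;> simp [h]

/-- Two permutations that bring `s` to the front differ by one fixing `0`, and the antisymmetry of
`c` absorbs its sign; the choice made in `cone` is immaterial. -/
theorem cone_apply {C : PreAbstractSimplicialComplex V} {k : ℕ} {s : V} {c : (Fin k → V) → F}
    (hc : c ∈ chains F C k) {v : Fin (k + 1) → V} (hv : Function.Injective v)
    (ρ : Equiv.Perm (Fin (k + 1))) (hρ : v (ρ 0) = s) :
    cone s c v = ((Equiv.Perm.sign ρ : ℤ) : F) * c (Fin.tail (v ∘ ρ)) := by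
  have h : Function.Injective v ∧ ∃ ρ : Equiv.Perm (Fin (k + 1)), v (ρ 0) = s := ⟨hv, ρ, hρ⟩
  rw [cone, dif_pos h]
  generalize hρ' : h.2.choose = ρ'
  have h0 : v (ρ' 0) = s := hρ' ▸ h.2.choose_spec
  -- Here `p` is the image of `0` under `ρ⁻¹ * ρ'`; it is `0` because `ρ` and `ρ'` send `0` to the
  -- unique position of `s`.
  obtain ⟨⟨p, τ⟩, hτ⟩ := Equiv.Perm.decomposeFin.symm.surjective (ρ⁻¹ * ρ')
  have hp : p = 0 := by
    have := congrArg (fun f : Equiv.Perm (Fin (k + 1)) => f 0) hτ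
    simp only [Equiv.Perm.decomposeFin_symm_apply_zero, Equiv.Perm.mul_apply] at this
    rw [this, hv (h0.trans hρ.symm)]
    simp
  subst hp
  have hmul : ρ' = ρ * Equiv.Perm.decomposeFin.symm (0, τ) := by rw [hτ]; simp
  have htail : Fin.tail (v ∘ ρ') = Fin.tail (v ∘ ρ) ∘ τ := by
    ext i
    simp [Fin.tail, hmul]
  rw [htail, hc.1, hmul, map_mul, Equiv.Perm.decomposeFin.symm_sign]
  simp only [if_true, one_mul, Units.val_mul, Int.cast_mul, mul_assoc, sign_mul_sign_mul]

theorem cone_apply_of_notMem {k : ℕ} {s : V} (c : (Fin k → V) → F) {v : Fin (k + 1) → V}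
    (hv : s ∉ univ.image v) : cone s c v = 0 := by
  rw [cone, dif_neg]
  rintro ⟨-, ρ, rfl⟩
  exact hv (mem_image_of_mem _ (mem_univ _))

theorem cone_apply_of_not_injective {k : ℕ} {s : V} (c : (Fin k → V) → F) {v : Fin (k + 1) → V}
    (hv : ¬ Function.Injective v) : cone s c v = 0 := by
  rw [cone, dif_neg fun h => hv h.1]

theorem cone_cons {C : PreAbstractSimplicialComplex V} {k : ℕ} {s : V} {c : (Fin k → V) → F}
    (hc : c ∈ chains F C k) {w : Fin k → V} (hw : s ∉ univ.image w) :
    cone s c (Fin.cons s w) = c w := by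
  by_cases hinj : Function.Injective w
  · rw [cone_apply hc (Fin.cons_injective_iff.2 ⟨by simpa using hw, hinj⟩) 1 (by simp)]
    simp
  · rw [cone_apply_of_not_injective _ fun h => hinj (Fin.cons_injective_iff.1 h).2]
    by_contra hne
    exact hinj (hc.2 w (Ne.symm hne)).1

theorem cone_mem_chains {C D : PreAbstractSimplicialComplex V} {k : ℕ} {s : V}
    {c : (Fin k → V) → F} (hc : c ∈ chains F C k)
    (hD : ∀ t, IsFace C t → IsFace D (insert s t)) : cone s c ∈ chains F D (k + 1) := by
  refine ⟨fun σ v => ?_, fun v hv => ?_⟩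
  · by_cases hinj : Function.Injective v
    · by_cases hs : s ∈ univ.image v
      · obtain ⟨ρ, hρ⟩ := exists_perm_apply_zero hs
        rw [cone_apply hc hinj ρ hρ, cone_apply hc (hinj.comp σ.injective) (σ⁻¹ * ρ) (by simpa)]
        have : (v ∘ σ) ∘ (σ⁻¹ * ρ : Equiv.Perm _) = v ∘ ρ := by ext; simp
        rw [this, map_mul, map_inv, Int.units_inv_eq_self]
        simp [mul_assoc]
      · rw [cone_apply_of_notMem _ hs, cone_apply_of_notMem _ (by rwa [image_comp_perm]), mul_zero]
    · rw [cone_apply_of_not_injective _ hinj, cone_apply_of_not_injective, mul_zero]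
      intro h
      refine hinj ?_
      have := h.comp σ.symm.injective
      rwa [Function.comp_assoc, Equiv.self_comp_symm] at this
  · have hinj : Function.Injective v := by
      by_contra h; exact hv (cone_apply_of_not_injective _ h)
    have hs : s ∈ univ.image v := by by_contra h; exact hv (cone_apply_of_notMem _ h)
    obtain ⟨ρ, hρ⟩ := exists_perm_apply_zero hs
    rw [cone_apply hc hinj ρ hρ, ne_eq, sign_smul_ne_zero] at hv
    have := hD _ (hc.2 _ hv).2
    refine ⟨hinj, ?_⟩
    rw [← image_comp_perm v ρ, ← Fin.cons_self_tail (v ∘ ρ), image_cons]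
    simpa [hρ] using this

/-- Chains that vanish on the tuples without `s` have simple boundaries there. -/
theorem boundary_apply_of_notMem {k : ℕ} {s : V} {c : (Fin (k + 1) → V) → F}
    (hc : ∀ v, s ∉ univ.image v → c v = 0) {w : Fin k → V} (hw : s ∉ univ.image w) :
    boundary F k c w = c (Fin.cons s w) := by
  rw [boundary_apply]
  refine sum_eq_single s (fun x _ hx => hc _ ?_) (fun h => absurd (mem_univ s) h)
  rw [image_cons, mem_insert, not_or]
  exact ⟨hx.symm, hw⟩

/-- Cones are acyclic. -/
theorem betti_eq_zero_of_cone {C : PreAbstractSimplicialComplex V} {s : V}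
    (hC : ∀ t, IsFace C t → IsFace C (insert s t)) (k : ℕ) : betti F C k = 0 := by
  rw [betti_eq_zero_iff]
  refine le_antisymm (fun z hz => ?_) (boundaries_le_cycles C k)
  have hz' := cycles_le_chains C k hz
  -- Coning the part of `z` off `s` gives a chain whose boundary agrees with `z` on all tuples that
  -- miss `s`.
  have hc : restrictChain (fun t => s ∉ t) z ∈ chains F C k :=
    restrictChain_mem _ hz' fun _ h _ => h
  have hb := cone_mem_chains hc hC
  set c := restrictChain (fun t => s ∉ t) z with hcdef
  have hbd : boundary F k (cone s c) ∈ boundaries F C k := ⟨_, hb, rfl⟩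
  have hy : z - boundary F k (cone s c) ∈ cycles F C k :=
    Submodule.sub_mem _ hz (boundaries_le_cycles C k hbd)
  have hy0 : ∀ w, s ∉ univ.image w → (z - boundary F k (cone s c)) w = 0 := fun w hw => by
    rw [Pi.sub_apply, boundary_apply_of_notMem (fun v hv => cone_apply_of_notMem c hv) hw,
      cone_cons hc hw, hcdef, restrictChain, if_pos hw, sub_self]
  -- A cycle vanishing on the tuples without `s` is zero: its coefficient on [s, w] is that of its
  -- boundary on w.
  have key : z - boundary F k (cone s c) = 0 := by
    generalize z - boundary F k (cone s c) = y at hy hy0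
    cases k with
    | zero => ext w; exact hy0 w (by simp)
    | succ k =>
      ext v
      by_contra hne
      have hs : s ∈ univ.image v := by by_contra h; exact hne (hy0 v h)
      obtain ⟨ρ, hρ⟩ := exists_perm_apply_zero hs
      have h1 : y (v ∘ ρ) ≠ 0 := fun h => hne ((chains_comp_perm_eq_zero hy.1 _ _).1 h)
      have h2 : v ∘ ρ = Fin.cons s (Fin.tail (v ∘ ρ)) := by
        rw [← hρ]; exact (Fin.cons_self_tail (v ∘ ρ)).symm
      have hinj := (hy.1.2 _ h1).1
      rw [h2] at h1 hinj
      refine h1 ?_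
      rw [← boundary_apply_of_notMem hy0 (by simpa using (Fin.cons_injective_iff.1 hinj).1)]
      exact congrFun hy.2 _
  rw [sub_eq_zero] at key
  rw [key]
  exact hbd

/-! ### Simplices and their boundary spheres. -/

/-- The full simplex on a finite set. -/
def simplex (S : Finset V) : PreAbstractSimplicialComplex V where
  faces := {s | s.Nonempty ∧ s ⊆ S}
  isRelLowerSet_faces := fun _ hs => ⟨hs.1, fun _ hts ht => ⟨ht, hts.trans hs.2⟩⟩

theorem mem_simplex {S s : Finset V} : s ∈ simplex S ↔ s.Nonempty ∧ s ⊆ S := Iff.rfl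

theorem isFace_simplex {S s : Finset V} : IsFace (simplex S) s ↔ s ⊆ S := by
  rcases s.eq_empty_or_nonempty with rfl | h
  · simp [IsFace]
  · simp [IsFace, mem_simplex, h, h.ne_empty]

theorem simplex_le {C : PreAbstractSimplicialComplex V} {S : Finset V} (hS : S ∈ C) :
    simplex S ≤ C := fun _ (hs : _ ∈ simplex S) => mem_of_subset hS hs.2 hs.1

theorem betti_simplex {S : Finset V} (hS : S.Nonempty) (k : ℕ) : betti F (simplex S) k = 0 := by
  obtain ⟨s, hs⟩ := hS
  refine betti_eq_zero_of_cone (s := s) (fun t ht => ?_) k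
  rw [isFace_simplex] at *
  exact insert_subset hs ht

theorem chains_congr {C D : PreAbstractSimplicialComplex V} {k : ℕ}
    (h : ∀ s : Finset V, s.card = k → (IsFace C s ↔ IsFace D s)) :
    chains F C k = chains F D k := by
  ext c
  refine and_congr_right fun _ => forall_congr' fun v => imp_congr_right fun _ =>
    and_congr_right fun hv => h _ (card_image_of_injective' hv)

theorem chains_eq_bot {C : PreAbstractSimplicialComplex V} {k : ℕ}
    (h : ∀ s : Finset V, s.card = k → ¬ IsFace C s) : chains F C k = ⊥ := by
  rw [eq_bot_iff]
  intro c hc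
  ext v
  by_contra hne
  obtain ⟨h1, h2⟩ := hc.2 v hne
  exact h _ (card_image_of_injective' h1) h2

theorem cycles_congr {C D : PreAbstractSimplicialComplex V} {k : ℕ}
    (h : chains F C k = chains F D k) : cycles F C k = cycles F D k := by
  cases k with
  | zero => exact h
  | succ k => rw [cycles, h]; rfl

theorem boundaries_congr {C D : PreAbstractSimplicialComplex V} {k : ℕ}
    (h : chains F C (k + 1) = chains F D (k + 1)) : boundaries F C k = boundaries F D k := by
  rw [boundaries, h]; rfl

theorem boundaries_eq_bot {C : PreAbstractSimplicialComplex V} {k : ℕ}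
    (h : chains F C (k + 1) = ⊥) : boundaries F C k = ⊥ := by
  rw [boundaries, h, Submodule.map_bot]

theorem betti_congr {C D : PreAbstractSimplicialComplex V} {k : ℕ}
    (h : chains F C k = chains F D k) (h' : chains F C (k + 1) = chains F D (k + 1)) :
    betti F C k = betti F D k := by
  have h1 := betti_add_finrank_boundaries (F := F) C k
  have h2 := betti_add_finrank_boundaries (F := F) D k
  rw [cycles_congr h, boundaries_congr h'] at h1
  omega

theorem betti_eq_zero_of_chains {C : PreAbstractSimplicialComplex V} {k : ℕ}
    (h : chains F C k = ⊥) : betti F C k = 0 := by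
  have h1 := betti_add_finrank_boundaries (F := F) C k
  have h2 : cycles F C k = ⊥ := eq_bot_iff.2 ((cycles_le_chains C k).trans h.le)
  rw [h2, finrank_bot] at h1
  omega

/-- An orientation of a simplex. -/
theorem exists_chain_simplex (k : ℕ) : ∀ D : Finset V, D.card = k →
    ∃ ω ∈ chains F (simplex D) k, ω ≠ 0 := by
  induction k with
  | zero =>
    intro D _
    refine ⟨fun _ => 1, ⟨fun σ v => ?_, fun v _ => ⟨Function.injective_of_subsingleton v, ?_⟩⟩, ?_⟩
    · simp [Subsingleton.elim σ 1]
    · exact Or.inl (by simp)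
    · exact fun h => one_ne_zero (congrFun h Fin.elim0)
  | succ k ih =>
    intro D hD
    obtain ⟨s, D', hs, rfl, hD'⟩ := card_eq_succ.1 hD
    obtain ⟨ω, hω, hne⟩ := ih D' hD'
    obtain ⟨w, hw⟩ := Function.ne_iff.1 hne
    refine ⟨cone s ω, cone_mem_chains hω fun t ht => ?_, fun h => hw ?_⟩
    · rw [isFace_simplex] at *
      exact insert_subset_insert s ht
    · rw [← cone_cons hω (s := s) fun hmem => hs (isFace_simplex.1 (hω.2 w hw).2 hmem), h]
      rfl

/-- Only the face `D` has `k` elements, so antisymmetry lets one coefficient determine the whole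
chain. -/
theorem chains_simplex_eq_span {k : ℕ} {D : Finset V} (hD : D.card = k) {ω : (Fin k → V) → F}
    (hω : ω ∈ chains F (simplex D) k) (hne : ω ≠ 0) :
    chains F (simplex D) k = Submodule.span F {ω} := by
  refine le_antisymm (fun c hc => ?_) ((Submodule.span_singleton_le_iff_mem _ _).2 hω)
  have himg : ∀ {c : (Fin k → V) → F}, c ∈ chains F (simplex D) k → ∀ v, c v ≠ 0 →
      univ.image v = D := fun hc v hv => by
    obtain ⟨h1, h2⟩ := hc.2 v hv
    exact eq_of_subset_of_card_le (isFace_simplex.1 h2) (by rw [hD, card_image_of_injective' h1])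
  obtain ⟨v, hv⟩ := Function.ne_iff.1 hne
  rw [Submodule.mem_span_singleton]
  refine ⟨c v / ω v, ?_⟩
  have hmem : c - (c v / ω v) • ω ∈ chains F (simplex D) k :=
    Submodule.sub_mem _ hc (Submodule.smul_mem _ _ hω)
  have hzero : (c - (c v / ω v) • ω) v = 0 := by
    have : ω v ≠ 0 := hv
    simp [this]
  ext w
  by_contra hw
  have hw' : (c - (c v / ω v) • ω) w ≠ 0 := by
    rw [Pi.sub_apply, sub_ne_zero]; exact Ne.symm hw
  exact hw' (chains_eq_zero_of_image_eq hmem ((himg hω v hv).trans (himg hmem w hw').symm) hzero)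

theorem mem_removeFace {C : PreAbstractSimplicialComplex V} {s t : Finset V} :
    t ∈ removeFace C s ↔ t ∈ C ∧ ¬ s ⊆ t := Iff.rfl

theorem isFace_removeFace {C : PreAbstractSimplicialComplex V} {s t : Finset V}
    (hs : s.Nonempty) : IsFace (removeFace C s) t ↔ IsFace C t ∧ ¬ s ⊆ t := by
  rcases t.eq_empty_or_nonempty with rfl | h
  · simp [IsFace, subset_empty, hs.ne_empty]
  · simp [IsFace, mem_removeFace, h.ne_empty]

/-- The boundary of a simplex has the homology of a sphere. -/
theorem isHomologySphere_boundary {m : ℕ} {D : Finset V} (hD : D.card = m + 1)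
    {ω : (Fin (m + 1) → V) → F} (hω : ω ∈ chains F (simplex D) (m + 1)) (hne : ω ≠ 0) :
    IsHomologySphere F (removeFace (simplex D) D) m (boundary F m ω) := by
  have hDne : D.Nonempty := card_pos.1 (by omega)
  -- Removing `D` leaves the faces with at most `m` elements alone, so the acyclicity of the full
  -- simplex can be used in low degrees.
  have hlow : ∀ k ≤ m, chains F (removeFace (simplex D) D) k = chains F (simplex D) k :=
    fun k hk => chains_congr fun s hs => by
      rw [isFace_removeFace hDne, and_iff_left_iff_imp]
      intro _ hsub
      have := card_le_card hsub
      omega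
  have hhigh : ∀ k, m < k → chains F (removeFace (simplex D) D) k = ⊥ := fun k hk =>
    chains_eq_bot fun s hs => by
      rw [isFace_removeFace hDne, isFace_simplex]
      rintro ⟨h1, h2⟩
      exact h2 (eq_of_subset_of_card_le h1 (by omega)).symm.subset
  refine ⟨fun h0 => hne ?_, ?_, boundaries_eq_bot (hhigh _ (Nat.lt_succ_self m)), fun k hk => ?_⟩
  -- Otherwise `ω` would be a cycle, hence a boundary, of a simplex without faces of `m + 2`
  -- elements.
  · have h1 : ω ∈ cycles F (simplex D) (m + 1) := ⟨hω, h0⟩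
    rw [(betti_eq_zero_iff _ _).1 (betti_simplex hDne (m + 1)), boundaries_eq_bot] at h1
    · exact h1
    · refine chains_eq_bot fun s hs => ?_
      rw [isFace_simplex]
      intro h
      have := card_le_card h
      omega
  · rw [cycles_congr (hlow m le_rfl), (betti_eq_zero_iff _ _).1 (betti_simplex hDne m), boundaries,
      chains_simplex_eq_span hD hω hne, Submodule.map_span, Set.image_singleton]
  · rcases lt_or_gt_of_ne hk with h | h
    · rw [betti_congr (hlow k h.le) (hlow (k + 1) h), betti_simplex hDne]
    · exact betti_eq_zero_of_chains (hhigh k h)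

/-- The complex without vertices has the homology of the sphere of dimension `-1`. -/
theorem isHomologySphere_bot :
    IsHomologySphere F (⊥ : PreAbstractSimplicialComplex V) 0 (fun _ => 1) := by
  have hbot : ∀ k, chains F (⊥ : PreAbstractSimplicialComplex V) (k + 1) = ⊥ := fun k =>
    chains_eq_bot fun s hs => by
      rintro (rfl | h)
      · simp at hs
      · exact h
  refine ⟨fun h => one_ne_zero (congrFun h Fin.elim0), ?_, boundaries_eq_bot (hbot 0),
    fun k hk => ?_⟩
  · refine le_antisymm (fun c _ => ?_) ?_
    · rw [Submodule.mem_span_singleton]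
      refine ⟨c Fin.elim0, ?_⟩
      ext v
      simp [Subsingleton.elim v Fin.elim0]
    · rw [Submodule.span_singleton_le_iff_mem]
      refine ⟨fun σ v => ?_, fun v _ => ⟨Function.injective_of_subsingleton v, Or.inl (by simp)⟩⟩
      simp [Subsingleton.elim σ 1]
  · obtain ⟨k, rfl⟩ := Nat.exists_eq_succ_of_ne_zero hk
    exact betti_eq_zero_of_chains (hbot k)

/-- A vertex kills the class of the empty face; this decides the sphere term for disjoint unions. -/
theorem one_mem_boundaries_zero {C : PreAbstractSimplicialComplex V} :
    (fun _ => 1 : (Fin 0 → V) → F) ∈ boundaries F C 0 ↔ ∃ v, {v} ∈ C := by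
  constructor
  · rintro ⟨c, hc, h⟩
    have h1 := congrFun h Fin.elim0
    rw [boundary_apply] at h1
    obtain ⟨x, -, hx⟩ := exists_ne_zero_of_sum_ne_zero (h1.trans_ne one_ne_zero)
    refine ⟨x, ?_⟩
    have h2 := (hc.2 _ hx).2
    rw [image_cons] at h2
    simpa [IsFace] using h2
  · rintro ⟨v, hv⟩
    have h1 : (fun _ => 1 : (Fin 0 → V) → F) ∈ cycles F (simplex {v}) 0 :=
      ⟨fun σ v => by simp [Subsingleton.elim σ 1],
        fun v _ => ⟨Function.injective_of_subsingleton v, Or.inl (by simp)⟩⟩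
    rw [(betti_eq_zero_iff _ _).1 (betti_simplex (singleton_nonempty v) 0)] at h1
    exact boundaries_mono (simplex_le hv) 0 h1

/-! ### Gluing along the boundary of a simplex -/

variable (F) in
/-- There is a cycle on simplices with `k` vertices with a nonzero coefficient on `D`. -/
def HasCycleThrough (C : PreAbstractSimplicialComplex V) (k : ℕ) (D : Finset V) : Prop :=
  ∃ z ∈ cycles F C k, ∃ v, univ.image v = D ∧ z v ≠ 0

/-- If a chain `c` avoiding `D` has the boundary of `ω`, then `ω - c` is a cycle through `D`.
Conversely, a multiple of a cycle through `D` cancels the coefficient of `ω` on `D` without changing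
its boundary. -/
theorem boundary_mem_boundaries_removeFace {C : PreAbstractSimplicialComplex V} {m : ℕ}
    {D : Finset V} (hDC : D ∈ C) (hD : D.card = m + 1)
    {ω : (Fin (m + 1) → V) → F} (hω : ω ∈ chains F (simplex D) (m + 1)) (hne : ω ≠ 0) :
    boundary F m ω ∈ boundaries F (removeFace C D) m ↔ HasCycleThrough F C (m + 1) D := by
  have hDne : D.Nonempty := nonempty_of_mem hDC
  have hωC : ω ∈ chains F C (m + 1) :=
    chains_mono (simplex_le hDC) _ hω
  have hle : removeFace C D ≤ C := fun s hs => hs.1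
  have himg : ∀ v, ω v ≠ 0 → univ.image v = D := fun v hv =>
    eq_of_subset_of_card_le (isFace_simplex.1 (hω.2 v hv).2)
      (by rw [hD, card_image_of_injective' (hω.2 v hv).1])
  obtain ⟨v, hv⟩ := Function.ne_iff.1 hne
  have hvD := himg v hv
  constructor
  · rintro ⟨c, hc, hcω⟩
    refine ⟨ω - c, ⟨Submodule.sub_mem _ hωC (chains_mono hle _ hc), ?_⟩, v, hvD, ?_⟩
    · change boundary F m (ω - c) = 0
      rw [map_sub, hcω, sub_self]
    · have : c v = 0 := by
        by_contra h
        have := (hc.2 v h).2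
        rw [hvD, isFace_removeFace hDne] at this
        exact this.2 subset_rfl
      simpa [this] using hv
  · rintro ⟨z, hz, w, hwD, hw⟩
    have hzv : z v ≠ 0 := fun h => hw (chains_eq_zero_of_image_eq hz.1 (hvD.trans hwD.symm) h)
    have hmem : ω - (ω v / z v) • z ∈ chains F C (m + 1) :=
      Submodule.sub_mem _ hωC (Submodule.smul_mem _ _ hz.1)
    refine ⟨ω - (ω v / z v) • z, ⟨hmem.1, fun u hu => ⟨(hmem.2 u hu).1, ?_⟩⟩, ?_⟩
    · rw [isFace_removeFace hDne]
      refine ⟨(hmem.2 u hu).2, fun hsub => hu ?_⟩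
      have hDu := eq_of_subset_of_card_le hsub
        (by rw [hD, card_image_of_injective' (hmem.2 u hu).1])
      refine chains_eq_zero_of_image_eq hmem (hvD.trans hDu) ?_
      simp [hzv]
    · have : boundary F m z = 0 := hz.2
      rw [map_sub, map_smul, this, smul_zero, sub_zero]

theorem removeFace_sup_simplex {C : PreAbstractSimplicialComplex V} {D : Finset V}
    (hD : IsFacet C D) : removeFace C D ⊔ simplex D = C := by
  refine SetLike.ext fun s => ?_
  rw [mem_sup_complex, mem_removeFace, mem_simplex]
  constructor
  · rintro (h | h)
    · exact h.1
    · exact mem_of_subset hD.1 h.2 h.1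
  · intro h
    by_cases hs : D ⊆ s
    · exact Or.inr ⟨nonempty_of_mem h, (hD.2 s h hs).symm.subset⟩
    · exact Or.inl ⟨h, hs⟩

theorem removeFace_inf_simplex {C : PreAbstractSimplicialComplex V} {D : Finset V}
    (hD : D ∈ C) : removeFace C D ⊓ simplex D = removeFace (simplex D) D := by
  refine SetLike.ext fun s => ?_
  rw [mem_inf_complex, mem_removeFace, mem_simplex, mem_removeFace, mem_simplex]
  constructor
  · rintro ⟨h, h'⟩
    exact ⟨h', h.2⟩
  · rintro ⟨h, h'⟩
    exact ⟨⟨mem_of_subset hD h.2 h.1, h'⟩, h⟩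

theorem removeFace_inf_removeFace {C₁ C₂ : PreAbstractSimplicialComplex V} {D : Finset V}
    (h₁ : D ∈ C₁) (h₂ : D ∈ C₂) (h : ∀ s, s ∈ C₁ → s ∈ C₂ → s ⊆ D) :
    removeFace C₁ D ⊓ removeFace C₂ D = removeFace (simplex D) D := by
  refine SetLike.ext fun s => ?_
  rw [mem_inf_complex, mem_removeFace, mem_removeFace, mem_removeFace, mem_simplex]
  constructor
  · rintro ⟨h3, h4⟩
    exact ⟨⟨nonempty_of_mem h3.1, h s h3.1 h4.1⟩, h3.2⟩
  · rintro ⟨h3, h4⟩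
    exact ⟨⟨mem_of_subset h₁ h3.2 h3.1, h4⟩, ⟨mem_of_subset h₂ h3.2 h3.1, h4⟩⟩

variable (F) in
open Classical in
/-- `1` if there is a cycle through `D`, and `0` otherwise. -/
noncomputable def cycleIndicator (C : PreAbstractSimplicialComplex V) (k : ℕ) (D : Finset V) : ℤ :=
  if HasCycleThrough F C k D then 1 else 0

/-- Attaching the simplex `D` along its boundary sphere either completes a new cycle in degree `m +
1` or kills a class in degree `m`. -/
theorem betti_removeFace {C : PreAbstractSimplicialComplex V} {m : ℕ}
    {D : Finset V} (hDC : IsFacet C D) (hD : D.card = m + 1) (k : ℕ) :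
    (betti F C k : ℤ) = betti F (removeFace C D) k +
      (if k = m then cycleIndicator F C (m + 1) D - 1 else 0) +
      (if k = m + 1 then cycleIndicator F C (m + 1) D else 0) := by
  classical
  obtain ⟨ω, hω, hne⟩ := exists_chain_simplex (F := F) _ D hD
  have hS := isHomologySphere_boundary hD hω hne
  rw [← removeFace_inf_simplex hDC.1] at hS
  have h := hS.betti_sup k
  rw [removeFace_sup_simplex hDC, betti_simplex (nonempty_of_mem hDC.1),
    boundary_mem_boundaries_removeFace hDC.1 hD hω hne,
    if_congr (and_iff_left (show boundary F m ω ∈ boundaries F (simplex D) m from ⟨ω, hω, rfl⟩))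
      rfl rfl] at h
  simpa only [Nat.cast_zero, add_zero, cycleIndicator] using h

/-- Betti numbers of two complexes glued along the boundary of a common facet. -/
theorem betti_glue_facet {C₁ C₂ : PreAbstractSimplicialComplex V} {m : ℕ} {D : Finset V}
    (h₁ : IsFacet C₁ D) (h₂ : IsFacet C₂ D) (h : ∀ s, s ∈ C₁ → s ∈ C₂ → s ⊆ D)
    (hD : D.card = m + 1) (k : ℕ) :
    (betti F (removeFace C₁ D ⊔ removeFace C₂ D) k : ℤ) = betti F C₁ k + betti F C₂ k +
      (if k = m then (1 - cycleIndicator F C₁ (m + 1) D) * (1 - cycleIndicator F C₂ (m + 1) D)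
        else 0) +
      (if k = m + 1 then
        (1 - cycleIndicator F C₁ (m + 1) D) * (1 - cycleIndicator F C₂ (m + 1) D) - 1
        else 0) := by
  obtain ⟨ω, hω, hne⟩ := exists_chain_simplex (F := F) _ D hD
  have hS := isHomologySphere_boundary hD hω hne
  rw [← removeFace_inf_removeFace h₁.1 h₂.1 h] at hS
  have h := hS.betti_sup k
  rw [boundary_mem_boundaries_removeFace h₁.1 hD hω hne,
    boundary_mem_boundaries_removeFace h₂.1 hD hω hne] at h
  -- With indicators e₁, e₂, degree `m` changes by (1-e₁) + (1-e₂) from the removals and by e₁e₂ - 1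
  -- from the gluing; degree `m + 1` changes by -e₁ - e₂ + e₁e₂.
  rw [betti_removeFace h₁ hD, betti_removeFace h₂ hD, h]
  unfold cycleIndicator
  by_cases e₁ : HasCycleThrough F C₁ (m + 1) D <;>
    by_cases e₂ : HasCycleThrough F C₂ (m + 1) D <;>
    simp only [e₁, e₂, and_self, and_true, and_false, if_true, if_false] <;>
    split_ifs <;> omega

/-- Betti numbers of two complexes glued along a nonempty simplex. -/
theorem betti_glue_simplex {C₁ C₂ : PreAbstractSimplicialComplex V} {S : Finset V}
    (h : C₁ ⊓ C₂ = simplex S) (hS : S.Nonempty) (k : ℕ) :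
    betti F (C₁ ⊔ C₂) k = betti F C₁ k + betti F C₂ k :=
  betti_sup_of_acyclic (fun k => by rw [h, betti_simplex hS]) k

open Classical in
/-- Betti numbers of the union of two disjoint complexes. -/
theorem betti_disjoint {C₁ C₂ : PreAbstractSimplicialComplex V} (h : C₁ ⊓ C₂ = ⊥) (k : ℕ) :
    (betti F (C₁ ⊔ C₂) k : ℤ) = betti F C₁ k + betti F C₂ k +
      (if k = 0 then (if (∃ v, {v} ∈ C₁) ∧ ∃ v, {v} ∈ C₂ then 1 else 0) - 1 else 0) +
      (if k = 1 then (if (∃ v, {v} ∈ C₁) ∧ ∃ v, {v} ∈ C₂ then 1 else 0) else 0) := by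
  have hS := isHomologySphere_bot (F := F) (V := V)
  rw [← h] at hS
  have h := hS.betti_sup k
  rw [one_mem_boundaries_zero, one_mem_boundaries_zero] at h
  convert h

end

/-! ### Injective maps of ground sets -/

section

variable {F : Type*} [Field F] [Fintype V] [DecidableEq V] {G : Type*} [Fintype G] [DecidableEq G]

variable (F) in
/-- Pushing functions on tuples forward along a map of ground sets, by zero outside the range. -/
noncomputable def pushforward (f : V → G) (k : ℕ) :
    ((Fin k → V) → F) →ₗ[F] ((Fin k → G) → F) :=
  Function.ExtendByZero.linearMap F (fun v : Fin k → V => f ∘ v)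

theorem pushforward_apply_comp {f : V → G} (hf : Function.Injective f) {k : ℕ}
    (c : (Fin k → V) → F) (v : Fin k → V) : pushforward F f k c (f ∘ v) = c v :=
  (hf.comp_left).extend_apply c 0 v

theorem pushforward_apply_of_notMem (f : V → G) {k : ℕ} (c : (Fin k → V) → F) {w : Fin k → G}
    (hw : ¬ ∃ v, f ∘ v = w) : pushforward F f k c w = 0 :=
  Function.extend_apply' c (0 : (Fin k → G) → F) w hw

theorem pushforward_injective {f : V → G} (hf : Function.Injective f) (k : ℕ) :
    Function.Injective (pushforward F f k) := fun a b h => by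
  ext v
  rw [← pushforward_apply_comp hf a, h, pushforward_apply_comp hf]

theorem mem_map_complex {C : PreAbstractSimplicialComplex V} {f : V → G} {s : Finset G} :
    s ∈ C.map f ↔ ∃ t ∈ C, t.image f = s := Iff.rfl

theorem isFace_map {C : PreAbstractSimplicialComplex V} {f : V → G} {s : Finset G} :
    IsFace (C.map f) s ↔ ∃ t, IsFace C t ∧ t.image f = s := by
  constructor
  · rintro (rfl | ⟨t, ht, rfl⟩)
    · exact ⟨∅, Or.inl rfl, rfl⟩
    · exact ⟨t, Or.inr ht, rfl⟩
  · rintro ⟨t, rfl | ht, rfl⟩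
    · exact Or.inl rfl
    · exact Or.inr ⟨t, ht, rfl⟩

theorem image_comp' {k : ℕ} (f : V → G) (v : Fin k → V) :
    univ.image (f ∘ v) = (univ.image v).image f := (image_image).symm

theorem exists_comp_of_image_eq {k : ℕ} {f : V → G} {w : Fin k → G} {t : Finset V}
    (h : t.image f = univ.image w) : ∃ v, f ∘ v = w := by
  have h1 : ∀ i, ∃ x, f x = w i := fun i => by
    have : w i ∈ t.image f := h ▸ mem_image_of_mem w (mem_univ i)
    obtain ⟨x, -, hx⟩ := mem_image.1 this
    exact ⟨x, hx⟩
  choose v hv using h1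
  exact ⟨v, funext hv⟩

theorem chains_map {f : V → G} (hf : Function.Injective f) (C : PreAbstractSimplicialComplex V)
    (k : ℕ) : chains F (C.map f) k = (chains F C k).map (pushforward F f k) := by
  apply le_antisymm
  · intro c hc
    have hsupp : ∀ w, c w ≠ 0 → ∃ v, f ∘ v = w := fun w hw => by
      obtain ⟨t, -, ht⟩ := isFace_map.1 (hc.2 w hw).2
      exact exists_comp_of_image_eq ht
    refine ⟨fun v => c (f ∘ v), ⟨fun σ v => hc.1 σ (f ∘ v), fun v hv => ?_⟩, ?_⟩
    · obtain ⟨h1, h2⟩ := hc.2 _ hv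
      refine ⟨h1.of_comp, ?_⟩
      obtain ⟨t, ht, hti⟩ := isFace_map.1 h2
      rw [image_comp'] at hti
      rwa [← image_injective hf hti]
    · ext w
      by_cases hw : ∃ v, f ∘ v = w
      · obtain ⟨v, rfl⟩ := hw
        exact pushforward_apply_comp hf _ v
      · rw [pushforward_apply_of_notMem f _ hw]
        by_contra hne
        exact hw (hsupp w (Ne.symm hne))
  · rintro _ ⟨c, hc, rfl⟩
    refine ⟨fun σ w => ?_, fun w hw => ?_⟩
    · by_cases h : ∃ v, f ∘ v = w
      · obtain ⟨v, rfl⟩ := h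
        rw [pushforward_apply_comp hf, Function.comp_assoc, pushforward_apply_comp hf, hc.1]
      · rw [pushforward_apply_of_notMem f _ h, pushforward_apply_of_notMem, mul_zero]
        rintro ⟨v, hv⟩
        refine h ⟨v ∘ σ.symm, ?_⟩
        rw [← Function.comp_assoc, hv, Function.comp_assoc, Equiv.self_comp_symm,
          Function.comp_id]
    · by_cases h : ∃ v, f ∘ v = w
      · obtain ⟨v, rfl⟩ := h
        rw [pushforward_apply_comp hf] at hw
        refine ⟨hf.comp (hc.2 v hw).1, ?_⟩
        rw [image_comp']
        exact isFace_map.2 ⟨_, (hc.2 v hw).2, rfl⟩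
      · exact absurd (pushforward_apply_of_notMem f _ h) hw

/-- New first entries outside the range of `f` contribute zero, so the sum over `G` reduces to one
over `V`. -/
theorem boundary_pushforward {f : V → G} (hf : Function.Injective f) {k : ℕ}
    (c : (Fin (k + 1) → V) → F) :
    boundary F k (pushforward F f (k + 1) c) = pushforward F f k (boundary F k c) := by
  have hcons : ∀ (x : G) (w : Fin k → G) (u : Fin (k + 1) → V), f ∘ u = Fin.cons x w →
      f (u 0) = x ∧ f ∘ Fin.tail u = w := fun x w u hu => by
    constructor
    · simpa using congrFun hu 0
    · ext i; simpa [Fin.tail] using congrFun hu i.succ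
  ext w
  rw [boundary_apply]
  by_cases h : ∃ v, f ∘ v = w
  · obtain ⟨v, rfl⟩ := h
    rw [pushforward_apply_comp hf, boundary_apply]
    symm
    refine sum_of_injOn f hf.injOn (by simp) (fun x _ hx => ?_) fun x _ => ?_
    · refine pushforward_apply_of_notMem f c ?_
      rintro ⟨u, hu⟩
      exact hx ⟨u 0, by simp, (hcons _ _ u hu).1⟩
    · rw [← pushforward_apply_comp hf c, Fin.comp_cons]
  · rw [pushforward_apply_of_notMem f _ h]
    refine sum_eq_zero fun x _ => pushforward_apply_of_notMem f c ?_
    rintro ⟨u, hu⟩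
    exact h ⟨_, (hcons _ _ u hu).2⟩

theorem cycles_map {f : V → G} (hf : Function.Injective f) (C : PreAbstractSimplicialComplex V)
    (k : ℕ) : cycles F (C.map f) k = (cycles F C k).map (pushforward F f k) := by
  cases k with
  | zero => exact chains_map hf C 0
  | succ k =>
    ext c
    constructor
    · rintro ⟨h1, h2⟩
      rw [SetLike.mem_coe, chains_map hf] at h1
      obtain ⟨b, hb, rfl⟩ := h1
      refine ⟨b, ⟨hb, ?_⟩, rfl⟩
      have h3 : boundary F k (pushforward F f (k + 1) b) = 0 := h2
      rw [boundary_pushforward hf] at h3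
      exact pushforward_injective hf k (h3.trans (map_zero _).symm)
    · rintro ⟨b, ⟨hb, hb'⟩, rfl⟩
      have h3 : boundary F k b = 0 := hb'
      refine ⟨?_, ?_⟩
      · rw [SetLike.mem_coe, chains_map hf]
        exact ⟨b, hb, rfl⟩
      · change boundary F k (pushforward F f (k + 1) b) = 0
        rw [boundary_pushforward hf, h3, map_zero]

theorem boundaries_map {f : V → G} (hf : Function.Injective f)
    (C : PreAbstractSimplicialComplex V) (k : ℕ) :
    boundaries F (C.map f) k = (boundaries F C k).map (pushforward F f k) := by
  have h : boundary F k ∘ₗ pushforward F f (k + 1) = pushforward F f k ∘ₗ boundary F k :=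
    LinearMap.ext fun c => boundary_pushforward hf c
  rw [boundaries, chains_map hf, ← Submodule.map_comp, h, Submodule.map_comp]
  rfl

theorem betti_map {f : V → G} (hf : Function.Injective f)
    (C : PreAbstractSimplicialComplex V) (k : ℕ) : betti F (C.map f) k = betti F C k := by
  have h1 := betti_add_finrank_boundaries (F := F) C k
  have h2 := betti_add_finrank_boundaries (F := F) (C.map f) k
  rw [cycles_map hf, boundaries_map hf,
    ← (Submodule.equivMapOfInjective _ (pushforward_injective hf k) _).finrank_eq,
    ← (Submodule.equivMapOfInjective _ (pushforward_injective hf k) _).finrank_eq] at h2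
  omega

theorem hasCycleThrough_map {f : V → G} (hf : Function.Injective f)
    (C : PreAbstractSimplicialComplex V) (k : ℕ) (D : Finset V) :
    HasCycleThrough F (C.map f) k (D.image f) ↔ HasCycleThrough F C k D := by
  constructor
  · rintro ⟨z, hz, w, hw, hne⟩
    rw [cycles_map hf] at hz
    obtain ⟨c, hc, rfl⟩ := hz
    obtain ⟨v, rfl⟩ := exists_comp_of_image_eq hw.symm
    rw [pushforward_apply_comp hf] at hne
    rw [image_comp'] at hw
    exact ⟨c, hc, v, image_injective hf hw, hne⟩
  · rintro ⟨c, hc, v, hv, hne⟩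
    refine ⟨pushforward F f k c, ?_, f ∘ v, ?_, ?_⟩
    · rw [cycles_map hf]; exact ⟨c, hc, rfl⟩
    · rw [image_comp', hv]
    · rwa [pushforward_apply_comp hf]

theorem mem_induced {C : PreAbstractSimplicialComplex V} {W s : Finset V} :
    s ∈ induced C W ↔ s ∈ C ∧ s ⊆ W := Iff.rfl

theorem induced_map {f : V → G} (hf : Function.Injective f) (C : PreAbstractSimplicialComplex V)
    (W : Finset G) : induced (C.map f) W = (induced C (W.preimage f hf.injOn)).map f := by
  refine SetLike.ext fun s => ?_
  rw [mem_induced, mem_map_complex, mem_map_complex]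
  constructor
  · rintro ⟨⟨t, ht, rfl⟩, hW⟩
    exact ⟨t, ⟨ht, fun x hx => mem_preimage.2 (hW (mem_image_of_mem f hx))⟩, rfl⟩
  · rintro ⟨t, ⟨ht, htW⟩, rfl⟩
    exact ⟨⟨t, ht, rfl⟩, image_subset_iff.2 fun x hx => mem_preimage.1 (htW hx)⟩

/-! ### Cycles of pseudomanifolds -/

theorem exists_facet_superset {C : PreAbstractSimplicialComplex V} {s : Finset V} (hs : s ∈ C) :
    ∃ t, IsFacet C t ∧ s ⊆ t := by
  obtain ⟨t, hst, ht⟩ := (Set.toFinite {t : Finset V | t ∈ C}).exists_le_maximal hs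
  exact ⟨t, ⟨ht.1, fun u hu htu => le_antisymm htu (ht.2 hu htu)⟩, hst⟩

theorem IsPure.isFacet {C : PreAbstractSimplicialComplex V} {d : ℕ} (hC : IsPure d C)
    {s : Finset V} (hs : s ∈ C) (hcard : s.card = d + 1) : IsFacet C s := by
  obtain ⟨t, ht, hst⟩ := exists_facet_superset hs
  rwa [eq_of_subset_of_card_le hst (by rw [hC.2 t ht, hcard])]

theorem chains_apply_eq_or_eq_neg {C : PreAbstractSimplicialComplex V} {k : ℕ}
    {c : (Fin k → V) → F} (hc : c ∈ chains F C k) {v w : Fin k → V}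
    (hw : Function.Injective w) (h : univ.image v = univ.image w) : c w = c v ∨ c w = - c v := by
  obtain ⟨σ, rfl⟩ := exists_perm_of_image_eq hw h
  rw [hc.1]
  rcases Int.units_eq_one_or (Equiv.Perm.sign σ) with h | h <;> simp [h]

/-- Only two facets contain the common ridge, so the boundary coefficient there has two terms, which
must cancel. -/
theorem cycle_apply_of_adj {C : PreAbstractSimplicialComplex V} {d : ℕ}
    (hC : IsClosedPseudomanifold d C) {z : (Fin (d + 1) → V) → F} (hz : z ∈ cycles F C (d + 1))
    {s t : {s : Finset V // IsFacet C s}} (hadj : (adjacencyGraph d C).Adj s t)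
    {v w : Fin (d + 1) → V} (hv : Function.Injective v) (hw : Function.Injective w)
    (hvs : univ.image v = s.1) (hwt : univ.image w = t.1) : z w = z v ∨ z w = - z v := by
  obtain ⟨hne, r, hr, hrd, hrs, hrt⟩ := hadj
  have hpair : {s.1, t.1} = {u | IsFacet C u ∧ r ⊆ u} := by
    refine Set.eq_of_subset_of_ncard_le ?_ ?_ (Set.toFinite _)
    · rintro u (rfl | rfl)
      · exact ⟨s.2, hrs⟩
      · exact ⟨t.2, hrt⟩
    · rw [hC.ridge r hr hrd, Set.ncard_pair fun h => hne (Subtype.ext h)]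
  obtain ⟨u, hu, hur⟩ := exists_injective_image_eq hrd
  have hins : ∀ a : {s : Finset V // IsFacet C s}, r ⊆ a.1 → ∃ x ∉ r, insert x r = a.1 :=
    fun a ha => (exists_eq_insert_iff.2 ⟨ha, by rw [hrd, hC.pure.2 _ a.2]⟩)
  obtain ⟨x, hxr, hx⟩ := hins s hrs
  obtain ⟨y, hyr, hy⟩ := hins t hrt
  have hxy : x ≠ y := by
    rintro rfl
    exact hne (Subtype.ext (hx.symm.trans hy))
  have hsum : z (Fin.cons x u) + z (Fin.cons y u) = 0 := by
    have h0 : boundary F d z u = 0 := congrFun hz.2 u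
    rw [boundary_apply, sum_eq_add x y hxy _ (by simp) (by simp)] at h0
    · exact h0
    · rintro q - ⟨hqx, hqy⟩
      by_contra hq
      obtain ⟨h1, h2⟩ := hz.1.2 _ hq
      have hcard := card_image_of_injective' h1
      rw [image_cons, hur] at h2 hcard
      have hq' : insert q r ∈ C := h2.resolve_left (insert_ne_empty _ _)
      have hqr : q ∉ r := fun h => by rw [insert_eq_of_mem h] at hcard; omega
      have hmem : insert q r ∈ ({s.1, t.1} : Set (Finset V)) := by
        rw [hpair]
        exact ⟨hC.pure.isFacet hq' hcard, subset_insert _ _⟩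
      rcases hmem with h | h
      · rw [← hx] at h
        exact hqx ((insert_inj hqr).1 h)
      · rw [Set.mem_singleton_iff, ← hy] at h
        exact hqy ((insert_inj hqr).1 h)
  have h1 := chains_apply_eq_or_eq_neg hz.1 (v := Fin.cons x u) hv (by rw [image_cons, hur, hx, hvs])
  have h2 := chains_apply_eq_or_eq_neg hz.1 (v := Fin.cons y u) hw (by rw [image_cons, hur, hy, hwt])
  rw [eq_neg_of_add_eq_zero_left hsum] at h1
  rcases h1 with h1 | h1 <;> rcases h2 with h2 | h2 <;> rw [h1, h2] <;> simp

/-- The coefficients of a top-dimensional cycle of a pseudomanifold agree up to sign. -/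
theorem cycle_apply_eq_or_eq_neg {C : PreAbstractSimplicialComplex V} {d : ℕ}
    (hC : IsClosedPseudomanifold d C) {z : (Fin (d + 1) → V) → F} (hz : z ∈ cycles F C (d + 1))
    {v w : Fin (d + 1) → V} (hv : Function.Injective v) (hw : Function.Injective w)
    (hvC : IsFacet C (univ.image v)) (hwC : IsFacet C (univ.image w)) :
    z w = z v ∨ z w = - z v := by
  obtain ⟨p⟩ := hC.stronglyConnected.preconnected ⟨_, hvC⟩ ⟨_, hwC⟩
  have key : ∀ (s t : {s : Finset V // IsFacet C s}) (_ : (adjacencyGraph d C).Walk s t)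
      (v w : Fin (d + 1) → V), Function.Injective v → Function.Injective w →
      univ.image v = s.1 → univ.image w = t.1 → z w = z v ∨ z w = - z v := by
    intro s t p
    induction p with
    | nil => exact fun v w _ hw hvs hwt => chains_apply_eq_or_eq_neg hz.1 hw (hvs.trans hwt.symm)
    | @cons s u t hadj _ ih =>
      intro v w hv hw hvs hwt
      obtain ⟨q, hq, hqu⟩ := exists_injective_image_eq (hC.pure.2 _ u.2)
      have h1 := cycle_apply_of_adj hC hz hadj hv hq hvs hqu
      have h2 := ih q w hq hw hqu hwt
      rcases h1 with h1 | h1 <;> rcases h2 with h2 | h2 <;> rw [h2, h1] <;> simp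
  exact key _ _ p v w hv hw rfl rfl

open Classical in
/-- The set of vertices. -/
noncomputable def vertexSet (C : PreAbstractSimplicialComplex V) : Finset V :=
  univ.filter fun v => {v} ∈ C

theorem mem_vertexSet {C : PreAbstractSimplicialComplex V} {v : V} :
    v ∈ vertexSet C ↔ {v} ∈ C := by simp [vertexSet]

theorem card_vertexSet (C : PreAbstractSimplicialComplex V) :
    (vertexSet C).card = vertexCount C := by
  rw [vertexCount, ← Set.ncard_coe_finset]
  congr 1
  ext v
  simp [mem_vertexSet]

theorem subset_vertexSet {C : PreAbstractSimplicialComplex V} {s : Finset V} (hs : s ∈ C) :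
    s ⊆ vertexSet C := fun _ hv =>
  mem_vertexSet.2 (mem_of_subset hs (singleton_subset_iff.2 hv) (singleton_nonempty _))

theorem induced_le (C : PreAbstractSimplicialComplex V) (W : Finset V) : induced C W ≤ C :=
  fun _ (h : _ ∈ induced C W) => h.1

theorem cycles_mono {C D : PreAbstractSimplicialComplex V} (h : C ≤ D) (k : ℕ) :
    cycles F C k ≤ cycles F D k := by
  cases k with
  | zero => exact chains_mono h 0
  | succ k => exact inf_le_inf_right _ (chains_mono h _)

/-- A cycle through `D` has the same nonzero coefficient, up to sign, on every facet of `C`.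
Dividing by it gives an orientation, and as every vertex lies on a facet in its support, `W`
contains all vertices. -/
theorem hasCycleThrough_induced_iff {C : PreAbstractSimplicialComplex V} {d : ℕ}
    (hC : IsClosedPseudomanifold d C) {D : Finset V} (hD : IsFacet C D) (W : Finset V) :
    HasCycleThrough F (induced C W) (d + 1) D ↔ IsOrientable F d C ∧ vertexSet C ⊆ W := by
  constructor
  · rintro ⟨z, hz, v, hvD, hne⟩
    have hzC := cycles_mono (induced_le C W) _ hz
    have hvinj := (hz.1.2 v hne).1
    have key : ∀ w, Function.Injective w → univ.image w ∈ C → z w = z v ∨ z w = - z v :=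
      fun w hw hwC => cycle_apply_eq_or_eq_neg hC hzC hvinj hw (hvD.symm ▸ hD)
        (hC.pure.isFacet hwC (card_image_of_injective' hw))
    refine ⟨⟨(z v)⁻¹ • z, Submodule.smul_mem _ _ hzC, fun w hw hwC => ?_⟩, fun x hx => ?_⟩
    · rcases key w hw hwC with h | h <;> simp [h, hne]
    · obtain ⟨t, ht, hxt⟩ := exists_facet_superset (mem_vertexSet.1 hx)
      obtain ⟨w, hw, rfl⟩ := exists_injective_image_eq (hC.pure.2 t ht)
      have hzw : z w ≠ 0 := by
        rcases key w hw ht.1 with h | h <;> simpa [h] using hne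
      have hface := (hz.1.2 w hzw).2.resolve_left (nonempty_of_mem ht.1).ne_empty
      exact hface.2 (singleton_subset_iff.1 hxt)
  · rintro ⟨⟨c, hc, hc'⟩, hW⟩
    have hind : induced C W = C := le_antisymm (induced_le C W)
      fun s (hs : s ∈ C) => ⟨hs, (subset_vertexSet hs).trans hW⟩
    obtain ⟨v, hv, hvD⟩ := exists_injective_image_eq (hC.pure.2 D hD)
    refine ⟨c, hind.symm ▸ hc, v, hvD, ?_⟩
    rcases hc' v hv (hvD.symm ▸ hD.1) with h | h <;> simp [h]

end

/-! ### Averages over subsets -/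

/-- The weight of a set of size `k` in a ground set of size `n`. -/
def weight (n k : ℕ) : ℚ := 1 / ((n + 1) * n.choose k)

/-- In the integral form of `weight` this is t + (1-t) = 1: a new ground-set element either belongs
to the subset or does not. -/
theorem weight_succ {n k : ℕ} (hk : k ≤ n) :
    weight (n + 1) k + weight (n + 1) (k + 1) = weight n k := by
  have h0 : (n.choose k : ℚ) ≠ 0 := by exact_mod_cast (Nat.choose_pos hk).ne'
  have h1 : ((n + 1).choose k : ℚ) ≠ 0 := by exact_mod_cast (Nat.choose_pos (by omega)).ne'
  have h2 : ((n + 1).choose (k + 1) : ℚ) ≠ 0 := by exact_mod_cast (Nat.choose_pos (by omega)).ne'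
  have e2 : ((n : ℚ) + 1) * n.choose k = (n + 1).choose (k + 1) * (k + 1) := by
    exact_mod_cast Nat.add_one_mul_choose_eq n k
  have e3 : ((n + 1).choose (k + 1) : ℚ) * (k + 1) = (n + 1).choose k * (n + 1 - k) := by
    have := Nat.choose_succ_right_eq (n + 1) k
    rw [← Nat.cast_inj (R := ℚ)] at this
    push_cast [Nat.cast_sub (show k ≤ n + 1 by omega)] at this
    exact this
  have hn : (n : ℚ) + 1 ≠ 0 := by positivity
  have hn2 : (n : ℚ) + 1 + 1 ≠ 0 := by positivity
  have hk1 : (k : ℚ) + 1 ≠ 0 := by positivity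
  have w1 : 1 / ((n + 1).choose k : ℚ) = (n + 1 - k) / ((n + 1) * n.choose k) := by
    rw [div_eq_div_iff h1 (mul_ne_zero hn h0), e2, e3]; ring
  have w2 : 1 / ((n + 1).choose (k + 1) : ℚ) = (k + 1) / ((n + 1) * n.choose k) := by
    rw [div_eq_div_iff h2 (mul_ne_zero hn h0), e2]; ring
  simp only [weight, Nat.cast_add, Nat.cast_one]
  have e : ∀ a b : ℚ, 1 / (a * b) = 1 / b / a := fun a b => by rw [div_div, mul_comm]
  rw [e, e, w1, w2, ← add_div, ← add_div]
  field_simp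
  ring

theorem sum_powerset_weight {α : Type*} [DecidableEq α] (T : Finset α) {n k : ℕ} (hk : k ≤ n) :
    ∑ J ∈ T.powerset, weight (n + T.card) (k + J.card) = weight n k := by
  induction T using Finset.induction_on with
  | empty => simp
  | insert a T ha ih =>
    rw [sum_powerset_insert ha, ← sum_add_distrib, ← ih]
    refine sum_congr rfl fun J hJ => ?_
    have hJT := card_le_card (mem_powerset.1 hJ)
    rw [card_insert_of_notMem ha, card_insert_of_notMem fun h => ha (mem_powerset.1 hJ h),
      ← add_assoc, ← add_assoc]
    exact weight_succ (by omega)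

section

variable [Fintype V] [DecidableEq V] {G : Type*} [Fintype G] [DecidableEq G]

/-- The weighted average over all subsets of the ground set. -/
def average (h : Finset V → ℚ) : ℚ := ∑ W : Finset V, weight (Fintype.card V) W.card * h W

theorem average_add (g h : Finset V → ℚ) :
    average (fun W => g W + h W) = average g + average h := by
  simp [average, mul_add, sum_add_distrib]

theorem average_sub (g h : Finset V → ℚ) :
    average (fun W => g W - h W) = average g - average h := by
  simp [average, mul_sub, sum_sub_distrib]

theorem average_mul (a : ℚ) (h : Finset V → ℚ) :
    average (fun W => a * h W) = a * average h := by
  simp only [average, mul_sum]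
  exact sum_congr rfl fun _ _ => by ring

/-- The fibre over `U` consists of the sets `U.image f ∪ J` with `J` outside the range of `f`;
`sum_powerset_weight` sums over `J`. -/
theorem sum_preimage_eq {f : V → G} (hf : Function.Injective f) (U : Finset V) :
    ∑ W ∈ univ.filter (fun W : Finset G => W.preimage f hf.injOn = U),
      weight (Fintype.card G) W.card = weight (Fintype.card V) U.card := by
  have hcard : Fintype.card G = Fintype.card V + ((univ : Finset V).image f)ᶜ.card := by
    have := card_compl_add_card ((univ : Finset V).image f)
    rw [card_image_of_injective _ hf, card_univ] at this
    omega
  rw [← sum_powerset_weight ((univ : Finset V).image f)ᶜ (card_le_univ U), hcard]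
  symm
  refine sum_bij' (fun J _ => U.image f ∪ J) (fun W _ => W ∩ ((univ : Finset V).image f)ᶜ)
    ?_ ?_ ?_ ?_ ?_
  · intro J hJ
    rw [mem_powerset] at hJ
    simp only [mem_filter, mem_univ, true_and]
    ext x
    simp only [mem_preimage, mem_union, mem_image, hf.eq_iff, exists_eq_right, or_iff_left_iff_imp]
    exact fun hx => absurd (mem_image_of_mem f (mem_univ x)) (mem_compl.1 (hJ hx))
  · exact fun W _ => mem_powerset.2 inter_subset_right
  · intro J hJ
    rw [mem_powerset] at hJ
    ext x
    simp only [mem_inter, mem_union, mem_compl, mem_image, mem_univ, true_and]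
    constructor
    · rintro ⟨⟨y, -, rfl⟩ | h, hx⟩
      · exact absurd ⟨y, rfl⟩ hx
      · exact h
    · exact fun h => ⟨Or.inr h, by simpa using hJ h⟩
  · intro W hW
    simp only [mem_filter, mem_univ, true_and] at hW
    subst hW
    ext x
    simp only [mem_inter, mem_union, mem_compl, mem_image, mem_univ, true_and, mem_preimage]
    constructor
    · rintro (⟨y, hy, rfl⟩ | h)
      · exact hy
      · exact h.1
    · intro h
      by_cases hx : ∃ y, f y = x
      · obtain ⟨y, rfl⟩ := hx
        exact Or.inl ⟨y, h, rfl⟩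
      · exact Or.inr ⟨h, hx⟩
  · intro J hJ
    rw [mem_powerset] at hJ
    rw [card_union_of_disjoint, card_image_of_injective _ hf]
    rw [disjoint_left]
    intro x hx hxJ
    exact mem_compl.1 (hJ hxJ) (image_subset_image (subset_univ U) hx)

/-- Averages do not change when the ground set is enlarged. -/
theorem average_preimage {f : V → G} (hf : Function.Injective f) (h : Finset V → ℚ) :
    average (fun W : Finset G => h (W.preimage f hf.injOn)) = average h := by
  unfold average
  rw [← sum_fiberwise (s := univ) (g := fun W : Finset G => W.preimage f hf.injOn)]
  refine sum_congr rfl fun U _ => ?_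
  rw [← sum_preimage_eq hf U, sum_mul]
  refine sum_congr rfl fun W hW => ?_
  simp only [(mem_filter.1 hW).2]

/-- Passing to the ground set `A` leaves a single contributing subset, of weight 1/(|A|+1). -/
theorem average_superset (A : Finset V) :
    average (fun W => if A ⊆ W then 1 else 0) = 1 / ((A.card : ℚ) + 1) := by
  have h := average_preimage (G := V) (f := ((↑) : A → V)) Subtype.val_injective
    (fun U => if U = univ then 1 else 0)
  have h1 : average (fun U : Finset A => if U = univ then (1 : ℚ) else 0) =
      1 / ((A.card : ℚ) + 1) := by
    rw [average, Fintype.sum_eq_single univ fun U hU => by rw [if_neg hU, mul_zero]]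
    simp [weight]
  rw [← h1, ← h]
  congr 1
  ext W
  congr 1
  simp [Finset.ext_iff, subset_iff]

theorem average_disjoint (A : Finset V) :
    average (fun W => if Disjoint A W then 1 else 0) = 1 / ((A.card : ℚ) + 1) := by
  have h := average_preimage (G := V) (f := ((↑) : A → V)) Subtype.val_injective
    (fun U => if U = ∅ then 1 else 0)
  have h1 : average (fun U : Finset A => if U = ∅ then (1 : ℚ) else 0) =
      1 / ((A.card : ℚ) + 1) := by
    rw [average, Fintype.sum_eq_single ∅ fun U hU => by rw [if_neg hU, mul_zero]]
    simp [weight]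
  rw [← h1, ← h]
  congr 1
  ext W
  congr 1
  simp [Finset.ext_iff, disjoint_left]

/-- The index `k` counts vertices of simplices, so dimension `i` corresponds to `k = i + 1`. -/
theorem tau_eq_average (F : Type*) [Field F] (C : PreAbstractSimplicialComplex V) (k : ℕ) :
    tau F C ((k : ℤ) - 1) = average fun W => (betti F (induced C W) k : ℚ) := by
  rw [tau, average, mul_sum]
  refine sum_congr rfl fun W _ => ?_
  rw [weight, betti, one_div_mul_eq_div, div_div, one_div_mul_eq_div, mul_comm]

/-- This allows complexes on different ground sets to be compared inside a common one. -/
theorem tau_map (F : Type*) [Field F] {f : V → G} (hf : Function.Injective f)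
    (C : PreAbstractSimplicialComplex V) (k : ℕ) :
    tau F (C.map f) ((k : ℤ) - 1) = tau F C ((k : ℤ) - 1) := by
  rw [tau_eq_average, tau_eq_average, ← average_preimage hf]
  simp only [induced_map hf, betti_map hf]

end

/-! ### Connected sums -/

section

variable {F : Type*} [Field F] {G : Type*} [Fintype G] [DecidableEq G]

theorem induced_sup (C₁ C₂ : PreAbstractSimplicialComplex G) (W : Finset G) :
    induced (C₁ ⊔ C₂) W = induced C₁ W ⊔ induced C₂ W :=
  SetLike.ext fun _ => or_and_right

theorem induced_removeFace (C : PreAbstractSimplicialComplex G) (D W : Finset G) :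
    induced (removeFace C D) W = removeFace (induced C W) D :=
  SetLike.ext fun _ => and_right_comm

theorem removeFace_induced_of_not_subset (C : PreAbstractSimplicialComplex G) {D W : Finset G}
    (h : ¬ D ⊆ W) : removeFace (induced C W) D = induced C W :=
  SetLike.ext fun s => by
    rw [mem_removeFace, and_iff_left_iff_imp]
    exact fun hs hD => h (hD.trans (mem_induced.1 hs).2)

theorem IsFacet.induced {C : PreAbstractSimplicialComplex G} {D W : Finset G} (hD : IsFacet C D)
    (h : D ⊆ W) : IsFacet (induced C W) D := ⟨⟨hD.1, h⟩, fun t ht => hD.2 t ht.1⟩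

theorem exists_vertex_induced {C : PreAbstractSimplicialComplex G} {W : Finset G} :
    (∃ v, {v} ∈ induced C W) ↔ ¬ Disjoint (vertexSet C) W := by
  simp [not_disjoint_iff, mem_induced, mem_vertexSet]

/-! ### Induced subcomplexes of a glued complex. -/

/-- `1` if `W` avoids `A`, and `0` otherwise. -/
def avoids (A W : Finset G) : ℚ := if Disjoint A W then 1 else 0

/-- `1` if `W` contains `A`, and `0` otherwise. -/
def contains (A W : Finset G) : ℚ := if A ⊆ W then 1 else 0

/-- The change of the Betti numbers of induced subcomplexes under gluing along the boundary of a
facet `D`, for complexes with the vertex sets `A₁` and `A₂` and with orientation indicators `e₁`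
and `e₂`. -/
def gluingDefect (d : ℕ) (e₁ e₂ : ℚ) (D A₁ A₂ : Finset G) (k : ℕ) (W : Finset G) : ℚ :=
  (if k ≤ 1 then 1 else 0) *
    (avoids D W - avoids A₁ W - avoids A₂ W + avoids (A₁ ∪ A₂) W) -
  (if k = 0 then 1 else 0) * avoids D W +
  (if k = d ∨ k = d + 1 then 1 else 0) * (contains D W - e₁ * contains A₁ W - e₂ * contains A₂ W +
    e₁ * e₂ * contains (A₁ ∪ A₂) W) -
  (if k = d + 1 then 1 else 0) * contains D W

/-- The cases are `D ⊆ W`, `D` disjoint from `W`, and neither: the pieces meet in a sphere, in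
nothing, or in a nonempty simplex. The first two exclude each other since `D` is nonempty, so their
corrections can be written as one sum. -/
theorem betti_glue_induced {d : ℕ} {C₁ C₂ : PreAbstractSimplicialComplex G}
    {D : Finset G} (h₁ : IsFacet C₁ D) (h₂ : IsFacet C₂ D)
    (h : ∀ s, s ∈ C₁ → s ∈ C₂ → s ⊆ D) (hD : D.card = d + 1) {e₁ e₂ : ℚ} {W : Finset G}
    (he₁ : (cycleIndicator F (induced C₁ W) (d + 1) D : ℚ) = e₁ * contains (vertexSet C₁) W)
    (he₂ : (cycleIndicator F (induced C₂ W) (d + 1) D : ℚ) = e₂ * contains (vertexSet C₂) W)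
    (k : ℕ) :
    (betti F (induced (removeFace C₁ D ⊔ removeFace C₂ D) W) k : ℚ) =
      betti F (induced C₁ W) k + betti F (induced C₂ W) k +
        gluingDefect d e₁ e₂ D (vertexSet C₁) (vertexSet C₂) k W := by
  have hD₁ := subset_vertexSet h₁.1
  have hD₂ := subset_vertexSet h₂.1
  have hDne : D.Nonempty := nonempty_of_mem h₁.1
  rw [induced_sup, induced_removeFace, induced_removeFace]
  by_cases hDW : D ⊆ W
  · have hg := betti_glue_facet (F := F) (h₁.induced hDW) (h₂.induced hDW)
      (fun s hs hs' => h s hs.1 hs'.1) hD k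
    have hdis : ∀ A : Finset G, D ⊆ A → avoids A W = 0 := fun A hA => by
      obtain ⟨x, hx⟩ := hDne
      exact if_neg fun h => disjoint_left.1 h (hA hx) (hDW hx)
    -- This expands the product (1-e₁c₁)(1-e₂c₂) into a linear combination of indicators, ready for
    -- averaging.
    have hun : contains (vertexSet C₁ ∪ vertexSet C₂) W =
        contains (vertexSet C₁) W * contains (vertexSet C₂) W := by
      simp only [contains, union_subset_iff, ite_and, ite_mul, one_mul, zero_mul]
    have hcD : contains D W = 1 := if_pos hDW
    rw [← Int.cast_inj (α := ℚ)] at hg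
    push_cast at hg
    rw [hg, he₁, he₂, gluingDefect, hdis D subset_rfl, hdis _ hD₁, hdis _ hD₂,
      hdis _ (hD₁.trans subset_union_left), hun, hcD]
    by_cases hk : k = d
    · have hk' : ¬ k = d + 1 := by omega
      rw [if_pos hk, if_neg hk', if_pos (Or.inl hk), if_neg hk']
      ring
    · by_cases hk' : k = d + 1
      · rw [if_neg hk, if_pos hk', if_pos (Or.inr hk'), if_pos hk']
        ring
      · rw [if_neg hk, if_neg hk', if_neg (not_or.2 ⟨hk, hk'⟩), if_neg hk']
        ring
  -- The face `D` is absent from both induced subcomplexes, so its removal has no effect.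
  · rw [removeFace_induced_of_not_subset _ hDW, removeFace_induced_of_not_subset _ hDW]
    have hcon : ∀ A : Finset G, D ⊆ A → contains A W = 0 := fun A hA =>
      if_neg fun h => hDW (hA.trans h)
    rw [gluingDefect, hcon D subset_rfl, hcon _ hD₁, hcon _ hD₂,
      hcon _ (hD₁.trans subset_union_left)]
    by_cases hdis : Disjoint D W
    · have hinf : induced C₁ W ⊓ induced C₂ W = ⊥ := by
        refine eq_bot_iff.2 fun s (hs : s ∈ _ ⊓ _) => ?_
        obtain ⟨⟨hs1, hsW⟩, hs2, -⟩ := mem_inf_complex.1 hs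
        obtain ⟨x, hx⟩ := nonempty_of_mem hs1
        exact disjoint_left.1 hdis (h s hs1 hs2 hx) (hsW hx)
      have hg := betti_disjoint (F := F) hinf k
      simp only [exists_vertex_induced] at hg
      have hun : avoids (vertexSet C₁ ∪ vertexSet C₂) W =
          avoids (vertexSet C₁) W * avoids (vertexSet C₂) W := by
        simp only [avoids, disjoint_union_left, ite_and, ite_mul, one_mul, zero_mul]
      have hite : ((if ¬ Disjoint (vertexSet C₁) W ∧ ¬ Disjoint (vertexSet C₂) W then 1 else 0 :
          ℤ) : ℚ) = (1 - avoids (vertexSet C₁) W) * (1 - avoids (vertexSet C₂) W) := by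
        by_cases a : Disjoint (vertexSet C₁) W <;> by_cases b : Disjoint (vertexSet C₂) W <;>
          simp [avoids, a, b]
      have haD : avoids D W = 1 := if_pos hdis
      rw [← Int.cast_inj (α := ℚ)] at hg
      rw [Int.cast_add, Int.cast_add, Int.cast_add, Int.cast_ite, Int.cast_ite, Int.cast_sub] at hg
      rw [hite] at hg
      push_cast at hg
      rw [hg, hun, haD]
      by_cases hk : k = 0
      · rw [if_pos hk, if_neg (by omega), if_pos (by omega), if_pos hk]
        ring
      · by_cases hk' : k = 1
        · rw [if_neg hk, if_pos hk', if_pos (by omega), if_neg hk]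
          ring
        · rw [if_neg hk, if_neg hk', if_neg (by omega), if_neg hk]
          ring
    · have hinf : induced C₁ W ⊓ induced C₂ W = simplex (D ∩ W) := by
        refine SetLike.ext fun s => ?_
        rw [mem_inf_complex, mem_induced, mem_induced, mem_simplex, subset_inter_iff]
        constructor
        · rintro ⟨⟨hs1, hsW⟩, hs2, -⟩
          exact ⟨nonempty_of_mem hs1, h s hs1 hs2, hsW⟩
        · rintro ⟨hne, hsD, hsW⟩
          exact ⟨⟨mem_of_subset h₁.1 hsD hne, hsW⟩, mem_of_subset h₂.1 hsD hne, hsW⟩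
      have hav : ∀ A : Finset G, D ⊆ A → avoids A W = 0 := fun A hA =>
        if_neg fun h => hdis (h.mono_left hA)
      rw [betti_glue_simplex hinf (not_disjoint_iff_nonempty_inter.1 hdis), hav D subset_rfl,
        hav _ hD₁, hav _ hD₂, hav _ (hD₁.trans subset_union_left)]
      push_cast
      ring

/-- The average of `gluingDefect`. -/
def averageDefect (d : ℕ) (e₁ e₂ : ℚ) (n₁ n₂ : ℕ) (k : ℕ) : ℚ :=
  (if k ≤ 1 then 1 else 0) * sumConst d n₁ n₂ - (if k = 0 then 1 else 0) * (1 / ((d : ℚ) + 2)) +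
  (if k = d ∨ k = d + 1 then 1 else 0) * (1 / ((d : ℚ) + 2) - e₁ / ((n₁ : ℚ) + 1) -
    e₂ / ((n₂ : ℚ) + 1) + e₁ * e₂ / ((n₁ : ℚ) + n₂ - d)) -
  (if k = d + 1 then 1 else 0) * (1 / ((d : ℚ) + 2))

theorem average_gluingDefect {d : ℕ} {e₁ e₂ : ℚ} {D A₁ A₂ : Finset G} (hD : D.card = d + 1)
    (h : A₁ ∩ A₂ = D) (k : ℕ) :
    average (gluingDefect d e₁ e₂ D A₁ A₂ k) = averageDefect d e₁ e₂ A₁.card A₂.card k := by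
  have hav : ∀ A : Finset G, average (avoids A) = 1 / ((A.card : ℚ) + 1) := average_disjoint
  have hcon : ∀ A : Finset G, average (contains A) = 1 / ((A.card : ℚ) + 1) := average_superset
  have hD' : (D.card : ℚ) + 1 = d + 2 := by rw [hD]; push_cast; ring
  -- Inclusion-exclusion with |D| = d + 1: the union has n = n₁ + n₂ - d - 1 elements.
  have hun : ((A₁ ∪ A₂).card : ℚ) + 1 = A₁.card + A₂.card - d := by
    have := card_union_add_card_inter A₁ A₂
    rw [h, hD, ← Nat.cast_inj (R := ℚ)] at this
    push_cast at this
    linarith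
  have hexp : average (gluingDefect d e₁ e₂ D A₁ A₂ k) =
      (if k ≤ 1 then 1 else 0) * (average (avoids D) - average (avoids A₁) - average (avoids A₂) +
        average (avoids (A₁ ∪ A₂))) - (if k = 0 then 1 else 0) * average (avoids D) +
      (if k = d ∨ k = d + 1 then 1 else 0) * (average (contains D) - e₁ * average (contains A₁) -
        e₂ * average (contains A₂) + e₁ * e₂ * average (contains (A₁ ∪ A₂))) -
      (if k = d + 1 then 1 else 0) * average (contains D) := by
    rw [show gluingDefect d e₁ e₂ D A₁ A₂ k = fun W => gluingDefect d e₁ e₂ D A₁ A₂ k W from rfl]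
    simp only [gluingDefect, average_add, average_sub, average_mul]
  rw [hexp, hav, hav, hav, hav, hcon, hcon, hcon, hcon, hD', hun, averageDefect, sumConst]
  ring

end

/-! ### Passage to the glued ground set. -/

section

variable (F : Type*) [Field F] {V₁ V₂ : Type*} [Fintype V₁] [DecidableEq V₁]
  [Fintype V₂] [DecidableEq V₂]

theorem glueRight_injective {D₁ : Finset V₁} {D₂ : Finset V₂} (φ : D₁ ≃ D₂) :
    Function.Injective (glueRight φ) := by
  intro a b hab
  unfold glueRight at hab
  split_ifs at hab with ha hb hb
  · have := φ.symm.injective (Subtype.ext (Sum.inl_injective hab))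
    exact congrArg Subtype.val this
  · exact congrArg Subtype.val (Sum.inr_injective hab)

theorem image_glueRight {D₁ : Finset V₁} {D₂ : Finset V₂} (φ : D₁ ≃ D₂) :
    D₂.image (glueRight φ) = D₁.image Sum.inl := by
  ext x
  simp only [mem_image]
  constructor
  · rintro ⟨b, hb, rfl⟩
    exact ⟨φ.symm ⟨b, hb⟩, (φ.symm ⟨b, hb⟩).2, by simp [glueRight, hb]⟩
  · rintro ⟨a, ha, rfl⟩
    exact ⟨φ ⟨a, ha⟩, (φ ⟨a, ha⟩).2, by simp [glueRight]⟩

theorem IsFacet.map {V G : Type*} [DecidableEq V] [DecidableEq G]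
    {C : PreAbstractSimplicialComplex V} {D : Finset V} (hD : IsFacet C D) {f : V → G}
    (hf : Function.Injective f) : IsFacet (C.map f) (D.image f) := by
  refine ⟨⟨D, hD.1, rfl⟩, ?_⟩
  rintro _ ⟨t, ht, rfl⟩ hsub
  exact congrArg _ (hD.2 t ht ((image_subset_image_iff hf).1 hsub))

theorem removeFace_map {V G : Type*} [Fintype V] [DecidableEq V] [Fintype G] [DecidableEq G]
    (C : PreAbstractSimplicialComplex V) (D : Finset V) {f : V → G} (hf : Function.Injective f) :
    (removeFace C D).map f = removeFace (C.map f) (D.image f) := by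
  refine SetLike.ext fun s => ?_
  rw [mem_removeFace, mem_map_complex, mem_map_complex]
  constructor
  · rintro ⟨t, ht, rfl⟩
    exact ⟨⟨t, ht.1, rfl⟩, fun h => ht.2 ((image_subset_image_iff hf).1 h)⟩
  · rintro ⟨⟨t, ht, rfl⟩, h⟩
    exact ⟨t, ⟨ht, fun h' => h (image_subset_image h')⟩, rfl⟩

theorem vertexSet_map {V G : Type*} [Fintype V] [DecidableEq V] [Fintype G] [DecidableEq G]
    (C : PreAbstractSimplicialComplex V) (f : V → G) :
    vertexSet (C.map f) = (vertexSet C).image f := by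
  ext x
  rw [mem_vertexSet, mem_map_complex, mem_image]
  constructor
  · rintro ⟨t, ht, htx⟩
    obtain ⟨y, hy⟩ := nonempty_of_mem ht
    refine ⟨y, subset_vertexSet ht hy, ?_⟩
    have := mem_image_of_mem f hy
    rwa [htx, mem_singleton] at this
  · rintro ⟨y, hy, rfl⟩
    exact ⟨{y}, mem_vertexSet.1 hy, by simp⟩

theorem cycleIndicator_induced_map {V G : Type*} [Fintype V] [DecidableEq V] [Fintype G]
    [DecidableEq G] {C : PreAbstractSimplicialComplex V} {d : ℕ}
    (hC : IsClosedPseudomanifold d C) {D : Finset V} (hD : IsFacet C D) {f : V → G}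
    (hf : Function.Injective f) (W : Finset G) :
    (cycleIndicator F (TauVector.induced (C.map f) W) (d + 1) (D.image f) : ℚ) =
      orientIndicator F d C * contains (vertexSet (C.map f)) W := by
  have h1 : HasCycleThrough F (TauVector.induced (C.map f) W) (d + 1) (D.image f) ↔
      IsOrientable F d C ∧ vertexSet (C.map f) ⊆ W := by
    rw [induced_map hf, hasCycleThrough_map hf, hasCycleThrough_induced_iff hC hD, vertexSet_map,
      image_subset_iff]
    simp only [subset_iff, mem_preimage]
  unfold cycleIndicator orientIndicator contains
  by_cases ho : IsOrientable F d C <;> by_cases hv : vertexSet (C.map f) ⊆ W <;>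
    simp [h1, ho, hv]

/-- The embedded summands share the facet `D₁.image Sum.inl` and have no common vertices outside it,
so the pointwise gluing formula applies to every `W` and can be averaged. -/
theorem tau_connectedSum {d : ℕ}
    {M₁ : PreAbstractSimplicialComplex V₁} {M₂ : PreAbstractSimplicialComplex V₂}
    (hM₁ : IsClosedPseudomanifold d M₁) (hM₂ : IsClosedPseudomanifold d M₂)
    {D₁ : Finset V₁} {D₂ : Finset V₂} (φ : D₁ ≃ D₂) (h₁ : IsFacet M₁ D₁) (h₂ : IsFacet M₂ D₂)
    (k : ℕ) :
    tau F (connectedSum M₁ M₂ φ) ((k : ℤ) - 1) =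
      tau F M₁ ((k : ℤ) - 1) + tau F M₂ ((k : ℤ) - 1) +
        averageDefect d (orientIndicator F d M₁) (orientIndicator F d M₂)
          (vertexCount M₁) (vertexCount M₂) k := by
  have hl : Function.Injective (Sum.inl : V₁ → GluedVertices V₁ D₂) := Sum.inl_injective
  have hr := glueRight_injective φ
  have hDD := image_glueRight φ
  have hcard : (D₁.image (Sum.inl : V₁ → GluedVertices V₁ D₂)).card = d + 1 := by
    rw [card_image_of_injective _ hl, hM₁.pure.2 _ h₁]
  have hf₁ := h₁.map hl
  have hf₂ := h₂.map hr
  have hcommon : ∀ s, s ∈ M₁.map (Sum.inl : V₁ → GluedVertices V₁ D₂) →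
      s ∈ M₂.map (glueRight φ) → s ⊆ D₁.image Sum.inl := by
    rintro _ ⟨s, hs, rfl⟩ ⟨t, ht, hts⟩ x hx
    obtain ⟨a, ha, rfl⟩ := mem_image.1 hx
    rw [← hts] at hx
    obtain ⟨b, hb, hba⟩ := mem_image.1 hx
    rw [← hDD, ← hba]
    refine mem_image_of_mem _ ?_
    -- Outside `D₂` the map `glueRight φ` takes values in the right summand, away from `V₁`.
    by_contra hbD
    simp [glueRight, hbD] at hba
  have hcs : connectedSum M₁ M₂ φ =
      removeFace (M₁.map (Sum.inl : V₁ → GluedVertices V₁ D₂)) (D₁.image Sum.inl) ⊔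
        removeFace (M₂.map (glueRight φ)) (D₁.image Sum.inl) := by
    rw [connectedSum, removeFace_map _ _ hl, removeFace_map _ _ hr, hDD]
  have hc₂ := cycleIndicator_induced_map F hM₂ h₂ hr
  rw [hDD] at hf₂ hc₂
  have hinter : vertexSet (M₁.map (Sum.inl : V₁ → GluedVertices V₁ D₂)) ∩
      vertexSet (M₂.map (glueRight φ)) = D₁.image Sum.inl := by
    refine subset_antisymm (fun x hx => ?_)
      (subset_inter (subset_vertexSet hf₁.1) (subset_vertexSet hf₂.1))
    rw [mem_inter, mem_vertexSet, mem_vertexSet] at hx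
    exact hcommon _ hx.1 hx.2 (mem_singleton_self x)
  rw [tau_eq_average, hcs]
  simp only [fun W => betti_glue_induced (F := F) hf₁ hf₂ hcommon hcard
    (cycleIndicator_induced_map F hM₁ h₁ hl W) (hc₂ W) k, average_add]
  rw [← tau_eq_average, ← tau_eq_average, tau_map F hl, tau_map F hr]
  congr 1
  rw [average_gluingDefect hcard hinter, vertexSet_map, vertexSet_map,
    card_image_of_injective _ hl, card_image_of_injective _ hr, card_vertexSet, card_vertexSet]

end

end TauVector

/-! ### The theorem. -/

open TauVector in
theorem mainTheorem2 (F : Type*) [Field F] {V₁ V₂ : Type*} [Fintype V₁] [DecidableEq V₁]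
    [Fintype V₂] [DecidableEq V₂] (d : ℕ) (hd : 2 ≤ d)
    (M₁ : PreAbstractSimplicialComplex V₁) (M₂ : PreAbstractSimplicialComplex V₂)
    (hM₁ : IsClosedManifold d M₁) (hM₂ : IsClosedManifold d M₂) :
    (∀ (D₁ : Finset V₁) (D₂ : Finset V₂) (φ : D₁ ≃ D₂), IsFacet M₁ D₁ → IsFacet M₂ D₂ →
      -- the entries in the range `1 ≤ i ≤ d - 2`
      (∀ i : ℤ, 1 ≤ i → i ≤ (d : ℤ) - 2 →
        tau F (connectedSum M₁ M₂ φ) i = tau F M₁ i + tau F M₂ i) ∧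
      -- the entry `i = 0`
      tau F (connectedSum M₁ M₂ φ) 0 =
        tau F M₁ 0 + tau F M₂ 0 + sumConst d (vertexCount M₁) (vertexCount M₂) ∧
      -- the entry `i = d - 1`, for orientable summands
      (IsOrientable F d M₁ → IsOrientable F d M₂ →
        tau F (connectedSum M₁ M₂ φ) ((d : ℤ) - 1) =
          tau F M₁ ((d : ℤ) - 1) + tau F M₂ ((d : ℤ) - 1) +
            sumConst d (vertexCount M₁) (vertexCount M₂)) ∧
      -- the entry `i = d - 1`, in general
      tau F (connectedSum M₁ M₂ φ) ((d : ℤ) - 1) =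
        tau F M₁ ((d : ℤ) - 1) + tau F M₂ ((d : ℤ) - 1) +
          (1 / ((d : ℚ) + 2)
            - orientIndicator F d M₁ / ((vertexCount M₁ : ℚ) + 1)
            - orientIndicator F d M₂ / ((vertexCount M₂ : ℚ) + 1)
            + orientIndicator F d M₁ * orientIndicator F d M₂ /
                ((vertexCount M₁ : ℚ) + vertexCount M₂ - d))) ∧
    -- the whole vector does not depend on the choices made in forming the connected sum
    (∀ (D₁ D₁' : Finset V₁) (D₂ D₂' : Finset V₂) (φ : D₁ ≃ D₂) (φ' : D₁' ≃ D₂'),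
      IsFacet M₁ D₁ → IsFacet M₂ D₂ → IsFacet M₁ D₁' → IsFacet M₂ D₂' →
        ∀ i : ℤ, -1 ≤ i →
          tau F (connectedSum M₁ M₂ φ) i = tau F (connectedSum M₁ M₂ φ') i) := by
  have key := fun (D₁ : Finset V₁) (D₂ : Finset V₂) (φ : D₁ ≃ D₂) (h₁ : IsFacet M₁ D₁)
    (h₂ : IsFacet M₂ D₂) => tau_connectedSum F hM₁.toIsClosedPseudomanifold
      hM₂.toIsClosedPseudomanifold φ h₁ h₂
  refine ⟨fun D₁ D₂ φ h₁ h₂ => ?_, fun D₁ D₁' D₂ D₂' φ φ' h₁ h₂ h₁' h₂' i hi => ?_⟩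
  · have hgen := key D₁ D₂ φ h₁ h₂ d
    -- As `d ≥ 2`, the corrections in degrees `0` and `1` do not overlap those in degrees `d` and `d
    -- + 1`.
    rw [averageDefect, if_neg (show ¬ d ≤ 1 by omega), if_neg (show ¬ d = 0 by omega),
      if_pos (Or.inl rfl), if_neg (show ¬ d = d + 1 by omega)] at hgen
    simp only [zero_mul, one_mul, sub_zero, zero_add] at hgen
    refine ⟨fun i hi hi' => ?_, ?_, fun ho₁ ho₂ => ?_, hgen⟩
    · obtain ⟨k, rfl⟩ : ∃ k : ℕ, i = (k : ℤ) - 1 := ⟨(i + 1).toNat, by omega⟩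
      rw [key D₁ D₂ φ h₁ h₂ k, averageDefect, if_neg (by omega), if_neg (by omega),
        if_neg (by omega), if_neg (by omega)]
      ring
    · have h := key D₁ D₂ φ h₁ h₂ 1
      rw [averageDefect, if_pos le_rfl, if_neg one_ne_zero, if_neg (by omega),
        if_neg (by omega)] at h
      simpa using h
    · rw [hgen, orientIndicator, orientIndicator, if_pos ho₁, if_pos ho₂, mul_one, sumConst]
  · obtain ⟨k, rfl⟩ : ∃ k : ℕ, i = (k : ℤ) - 1 := ⟨(i + 1).toNat, by omega⟩
    -- Neither right-hand side mentions the facets or the bijection, so they agree.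
    rw [key D₁ D₂ φ h₁ h₂ k, key D₁' D₂' φ' h₁' h₂' k]
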